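/- Fix integers $m\ge 0$ even, $k\ge 1$, $s\ge 0$ and $a_1,\dots,a_s\ge k$, and put $a=\sum_{i=1}^s(a_i+1)$. Given a $(2p+1)\times(2q+1)$ chessboard ($2p+1$ rows, $2q+1$ columns) with black corners, the Aztec rectangle $AR_{p,q}$ consists of its white squares, and the odd Aztec rectangle $O_{p,q}$ of its black squares. Squares of one colour are regarded as the unit squares of a square lattice rotated by $45^\circ$, two of them having a common side when the corresponding chessboard squares share a corner. Thus $AR_{p,q}$ and $O_{p,q}$ are regions of that lattice, and also graphs (vertices: the squares; edges: pairs of squares with a common side). For a region $S$, $M(S)$ is the number of its domino tilings; for a graph $G$, $M(G)$ is the number of its perfect matchings. Label the $m+a$ squares of $AR_{m,m+a}$ (the frame) on its horizontal symmetry axis $\ell$ by $1,2,\dots,m+a$ from left to right, and use these labels as coordinates on $\ell$. Let $c_1,\dots,c_s$ be such that $c_i-a_i/2$ is an integer, and let $A_i$ be the set of $a_i+1$ consecutive integers centered at $c_i$. Assume that $A_1,\dots,A_s$ are mutually disjoint and contained in $\{1,\dots,m+a\}$, and put $T=\{1,\dots,m+a\}\setminus\bigcup_i A_i=\{t_1<t_2<\dots<t_m\}$.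 For $0\le j\le k$ let $AR_{m+j,m+j+a}\setminus\bigcup_i O_{j,a_i-j}^{(c_i)}$ be the region obtained from the Aztec rectangle $AR_{m+j,m+j+a}$ centered around the frame by removing, for each $i$, a copy of $O_{j,a_i-j}$ whose center is the point of $\ell$ with coordinate $c_i$. Let $R(m,m+a;T)$ be the graph obtained from $AR_{m,m+a}$ by deleting all the vertices on $\ell$ whose labels are not in $T$, i.e. those with labels in $\bigcup_iA_i$. Then $$M\Bigl(AR_{m+k,m+k+a}\setminus\bigcup_i O_{k,a_i-k}^{(c_i)}\Bigr)=2^{\binom{k+1}{2}(s+1)+km}\,M\Bigl(AR_{m,m+a}\setminus\bigcup_i O_{0,a_i}^{(c_i)}\Bigr)=2^{\binom{k+1}{2}(s+1)+km}\,M\bigl(R(m,m+a;T)\bigr),$$ and this number is equal to $$2^{\binom{k+1}{2}(s+1)+km}\;\frac{2^{m(m+4)/4}}{\bigl(0!\,1!\cdots(m/2-1)!\bigr)^2}\prod_{1\le i<j\le m/2}(t_{2j-1}-t_{2i-1})(t_{2j}-t_{2i}).$$ -/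

import Mathlib

/-!
Conventions.  Squares of a (rotated) square lattice are described by "chessboard coordinates": a
square is a point `p = (x, y) : ℤ × ℤ`, with `x` the column and `y` the row of a chessboard square.
The chessboard squares of one colour, joined when they share a corner, form a square grid rotated by
45 degrees: they are the unit squares (or, dually, the vertices) of that grid, and two of them have
a common side (are adjacent) exactly when the chessboard squares share a corner.  In this picture
the rows `y = const` are the horizontal grid diagonals.
-/

/-- The unit squares `p`, `q` of the rotated grid have a common side; equivalently, the chessboard
squares `p`, `q` are diagonal neighbours. -/
def ShareSide (p q : ℤ × ℤ) : Prop :=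
  |p.1 - q.1| = 1 ∧ |p.2 - q.2| = 1

/-- The Aztec rectangle of height `m` and width `n`: the white squares of a `(2m+1) × (2n+1)`
chessboard (`2m+1` rows, `2n+1` columns) with black corners. -/
noncomputable def aztecRect (m n : ℕ) : Finset (ℤ × ℤ) :=
  (Finset.Icc (0 : ℤ) (2 * n) ×ˢ Finset.Icc (0 : ℤ) (2 * m)).filter fun p => Odd (p.1 + p.2)

/-- The odd Aztec rectangle of height `m` and width `n`: the black squares of a
`(2m+1) × (2n+1)` chessboard with black corners. -/
noncomputable def oddAztecRect (m n : ℕ) : Finset (ℤ × ℤ) :=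
  (Finset.Icc (0 : ℤ) (2 * n) ×ˢ Finset.Icc (0 : ℤ) (2 * m)).filter fun p => Even (p.1 + p.2)

/-- The translate of a region by the vector `v`. -/
noncomputable def translateRegion (S : Finset (ℤ × ℤ)) (v : ℤ × ℤ) : Finset (ℤ × ℤ) :=
  S.map (addRightEmbedding v)

/-- A domino: two unit squares with a common side. -/
def IsDomino (δ : Finset (ℤ × ℤ)) : Prop :=
  ∃ p q : ℤ × ℤ, ShareSide p q ∧ δ = {p, q}

/-- `D` is a domino tiling of the region `S`: a set of dominoes inside `S` such that every unit
square of `S` is covered exactly once. -/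
def IsDominoTiling (S : Finset (ℤ × ℤ)) (D : Finset (Finset (ℤ × ℤ))) : Prop :=
  (∀ δ ∈ D, IsDomino δ ∧ δ ⊆ S) ∧ ∀ p ∈ S, ∃! δ, δ ∈ D ∧ p ∈ δ

/-- The number of domino tilings of a region. -/
noncomputable def numDominoTilings (S : Finset (ℤ × ℤ)) : ℕ :=
  Nat.card {D : Finset (Finset (ℤ × ℤ)) // IsDominoTiling S D}

/-- The number of perfect matchings of a graph. -/
noncomputable def numPerfectMatchings {V : Type*} (G : SimpleGraph V) : ℕ :=
  Nat.card {M : G.Subgraph // M.IsPerfectMatching}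

/-- The graph whose vertices are the squares in `S`, adjacent when they have a common side
(as squares of the rotated grid). -/
def cellGraph (S : Finset (ℤ × ℤ)) : SimpleGraph S where
  Adj p q := ShareSide p.1 q.1
  symm := ⟨fun p q h => by
    simpa only [ShareSide, abs_sub_comm] using h⟩
  loopless := ⟨fun p h => by simp [ShareSide] at h⟩

/-- The vertices of `R(m, n; T)`, `m` even.  The horizontal symmetry axis of the Aztec rectangle of
height `m` and width `n` is the row `y = m`; the vertices on it are `(2t - 1, m)`, `t = 1, …, n`,
and `t` is the label of `(2t - 1, m)`.  All the vertices on the axis whose labels are not in `T`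
are deleted. -/
noncomputable def RVerts (m n : ℕ) (T : Finset ℤ) : Finset (ℤ × ℤ) :=
  aztecRect m n \ (Finset.Icc (1 : ℤ) n \ T).image fun t => (2 * t - 1, (m : ℤ))

/-- The graph `R(m, n; T)`, for even `m`. -/
noncomputable def RGraph (m n : ℕ) (T : Finset ℤ) : SimpleGraph (RVerts m n T) :=
  cellGraph (RVerts m n T)

/-- The window `O_{k, l}` whose center has coordinate `d / 2` on the horizontal symmetry axis of the
frame of height `m` (so `d` is twice the coordinate).  The frame is `aztecRect m n`, where the
square with label `t` on the axis is `(2t - 1, m)`; hence the point with coordinate `d / 2` is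
`(d - 1, m)`.  The center of `oddAztecRect k l` is `(l, k)`. -/
noncomputable def oddWindow (m k l : ℕ) (d : ℤ) : Finset (ℤ × ℤ) :=
  translateRegion (oddAztecRect k l) (d - 1 - l, m - k)

/-- The Aztec rectangle with odd windows
`AR_{m+k, m+k+a} ∖ (O_{k, a₁-k} ∪ ⋯ ∪ O_{k, aₛ-k})`, where `a = ∑ (aᵢ + 1)` and the center of the
`i`-th window has coordinate `dᵢ / 2` on the axis.  The outer rectangle is centered around the
frame `aztecRect m (m + a)`.  Meant for `k ≤ aᵢ`. -/
noncomputable def aztecRectWithWindows (m k : ℕ) {s : ℕ} (a : Fin s → ℕ) (d : Fin s → ℤ) : Finset (ℤ × ℤ) :=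
  translateRegion (aztecRect (m + k) (m + k + ∑ i, (a i + 1))) (-k, -k) \
    Finset.univ.biUnion fun i => oddWindow m k (a i - k) (d i)

/-- The set of `a + 1` consecutive integers centered at `d / 2`, where `d` and `a` have the same
parity (so the two divisions are exact). -/
noncomputable def centeredRun (a : ℕ) (d : ℤ) : Finset ℤ :=
  Finset.Icc ((d - a) / 2) ((d + a) / 2)

/-- The labels of the squares of the frame's axis that remain after removing the runs of `aᵢ + 1`
consecutive labels centered at `dᵢ / 2`; here the frame has width `m + a`, `a = ∑ (aᵢ + 1)`. -/
noncomputable def remainingLabels (m : ℕ) {s : ℕ} (a : Fin s → ℕ) (d : Fin s → ℤ) : Finset ℤ :=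
  Finset.Icc (1 : ℤ) (m + ∑ i, (a i + 1) : ℕ) \
    Finset.univ.biUnion fun i => centeredRun (a i) (d i)

/-! The proof combines a complementation argument, which removes the dependence on `k`, with an
exact evaluation at `k = 0`.

Complementation compares windows of height `k + 1` and `k`. Take as cells the chessboard squares of
the other colour with both coordinates congruent to `k` mod 2; each domino lies around exactly one
of them. In a tiling, each cell has a subset `A` of its four squares covered by its own dominoes.
Replacing `A` by its complement in every cell exchanges the two regions, because every square lies
in as many cells as there are regions containing it. On a four-cycle the matchings of `A` and of its
complement agree in number up to a power of two depending only on `|A|`, so the same holds for the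
tilings (`numExactCovers_complementation`). Counting squares gives the exponent `(k + 1)(s + 1) + m`
of one step (`GoodWindows.numDominoTilings_succ`). Windows of height `0` merely delete runs of
labels on the axis.

For the evaluation, cut along the axis: each remaining axis square is matched to one side or the
other, and a balance of rows forces `m / 2` of them to each side. Half of the rectangle together
with the axis labels `X` has a number of tilings proportional to the Vandermonde product of `X`
(`numDominoTilings_half`). This follows by removing rows alternately: an even row uses a column
operation on a Vandermonde determinant (`sum_vandProd_choices`), an odd row the dual identity for
complementary sets (`sum_vandProd_compl_choices`). The remaining sum, over balanced splittings of
`T`, of products of two Vandermonde products is a Laplace expansion. The determinant expanded also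
equals `2 ^ (m / 2)` times the single term that separates odd from even positions
(`sum_vandProd_mul_vandProd_compl`), which is the stated product. -/

/-! ### Exact covers -/

/-- `D` partitions the finite set `G` into blocks taken from `E`. -/
def IsExactCover {α : Type*} (E : Set (Finset α)) (G : Finset α) (D : Finset (Finset α)) : Prop :=
  (∀ δ ∈ D, δ ∈ E ∧ δ ⊆ G) ∧ ∀ p ∈ G, ∃! δ, δ ∈ D ∧ p ∈ δ

/-- The number of partitions of the finite set `G` into blocks taken from `E`. -/
noncomputable def numExactCovers {α : Type*} (E : Set (Finset α)) (G : Finset α) : ℕ :=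
  Nat.card {D : Finset (Finset α) // IsExactCover E G D}

theorem numDominoTilings_eq_numExactCovers (S : Finset (ℤ × ℤ)) :
    numDominoTilings S = numExactCovers {δ | IsDomino δ} S := rfl

section ExactCover

variable {α : Type*} {E E₁ E₂ : Set (Finset α)} {G : Finset α}

theorem finite_isExactCover (E : Set (Finset α)) (G : Finset α) :
    Finite {D : Finset (Finset α) // IsExactCover E G D} := by
  refine Set.Finite.subset (s := (G.powerset.powerset : Set (Finset (Finset α))))
    (Finset.finite_toSet _) ?_ |>.to_subtype
  intro D hD
  simp only [Finset.coe_powerset, Set.mem_preimage, Set.mem_powerset_iff]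
  intro δ hδ
  simpa using (hD.1 δ hδ).2

theorem IsExactCover.eq_of_mem {D : Finset (Finset α)} (h : IsExactCover E G D) {p : α}
    {δ ε : Finset α} (hδ : δ ∈ D) (hε : ε ∈ D) (hpδ : p ∈ δ) (hpε : p ∈ ε) : δ = ε :=
  (h.2 p ((h.1 δ hδ).2 hpδ)).unique ⟨hδ, hpδ⟩ ⟨hε, hpε⟩

theorem numExactCovers_congr {E' : Set (Finset α)} (h : ∀ δ ⊆ G, δ ∈ E ↔ δ ∈ E') :
    numExactCovers E G = numExactCovers E' G := by
  unfold numExactCovers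
  congr! 3 with D
  unfold IsExactCover
  congr! 3 with δ hδ
  exact and_congr_left fun hs => h δ hs

theorem numExactCovers_eq_zero {p : α} (hp : p ∈ G) (h : ∀ δ ∈ E, p ∈ δ → ¬ δ ⊆ G) :
    numExactCovers E G = 0 := by
  unfold numExactCovers
  rw [Nat.card_eq_zero]
  left
  refine ⟨fun ⟨D, hD⟩ => ?_⟩
  obtain ⟨δ, ⟨hδ, hpδ⟩, -⟩ := hD.2 p hp
  exact h δ (hD.1 δ hδ).1 hpδ (hD.1 δ hδ).2

theorem numExactCovers_empty (hE : ∅ ∉ E) : numExactCovers E ∅ = 1 := by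
  unfold numExactCovers
  rw [Nat.card_eq_one_iff_exists]
  refine ⟨⟨∅, by unfold IsExactCover; simp⟩, fun ⟨D, hD⟩ => Subtype.ext ?_⟩
  rw [Finset.eq_empty_iff_forall_notMem]
  intro δ hδ
  have h := hD.1 δ hδ
  rw [Finset.subset_empty] at h
  exact hE (h.2 ▸ h.1)

open Classical in
/-- Splitting the blocks of an exact cover into two classes. -/
theorem numExactCovers_union [DecidableEq α] (hE : Disjoint E₁ E₂) (G : Finset α) :
    numExactCovers (E₁ ∪ E₂) G =
      ∑ A ∈ G.powerset, numExactCovers E₁ A * numExactCovers E₂ (G \ A) := by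
  have hE' : ∀ δ, δ ∈ E₁ → δ ∈ E₂ → False := fun δ h₁ h₂ => Set.disjoint_left.1 hE h₁ h₂
  have key : {D : Finset (Finset α) // IsExactCover (E₁ ∪ E₂) G D} ≃
      Σ A : G.powerset, {D : Finset (Finset α) // IsExactCover E₁ A.1 D} ×
        {D : Finset (Finset α) // IsExactCover E₂ (G \ A.1) D} :=
    -- The index `A` is recovered from a cover as the union of its blocks of the first class.
    { toFun := fun D => ⟨⟨(D.1.filter (· ∈ E₁)).biUnion id, by
          rw [Finset.mem_powerset, Finset.biUnion_subset]
          intro δ hδ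
          exact (D.2.1 δ (Finset.mem_filter.1 hδ).1).2⟩,
          ⟨D.1.filter (· ∈ E₁), by
            refine ⟨fun δ hδ => ⟨(Finset.mem_filter.1 hδ).2,
              Finset.subset_biUnion_of_mem id hδ⟩, fun p hp => ?_⟩
            obtain ⟨δ, hδ, hpδ⟩ := Finset.mem_biUnion.1 hp
            refine ⟨δ, ⟨hδ, hpδ⟩, fun ε hε => ?_⟩
            exact D.2.eq_of_mem (Finset.mem_filter.1 hε.1).1 (Finset.mem_filter.1 hδ).1 hε.2 hpδ⟩,
          ⟨D.1.filter (· ∈ E₂), by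
            refine ⟨fun δ hδ => ⟨(Finset.mem_filter.1 hδ).2, fun p hp => ?_⟩, fun p hp => ?_⟩
            · have hδ' := Finset.mem_filter.1 hδ
              rw [Finset.mem_sdiff]
              refine ⟨(D.2.1 δ hδ'.1).2 hp, fun h => ?_⟩
              obtain ⟨ε, hε, hpε⟩ := Finset.mem_biUnion.1 h
              have hε' := Finset.mem_filter.1 hε
              have := D.2.eq_of_mem hδ'.1 hε'.1 hp hpε
              exact hE' δ (this ▸ hε'.2) hδ'.2
            · rw [Finset.mem_sdiff] at hp
              obtain ⟨δ, ⟨hδ, hpδ⟩, huniq⟩ := D.2.2 p hp.1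
              refine ⟨δ, ⟨Finset.mem_filter.2 ⟨hδ, ?_⟩, hpδ⟩,
                fun ε hε => huniq ε ⟨(Finset.mem_filter.1 hε.1).1, hε.2⟩⟩
              refine ((D.2.1 δ hδ).1).resolve_left fun h => hp.2 ?_
              exact Finset.mem_biUnion.2 ⟨δ, Finset.mem_filter.2 ⟨hδ, h⟩, hpδ⟩⟩⟩
      invFun := fun X => ⟨X.2.1.1 ∪ X.2.2.1, by
          obtain ⟨⟨A, hA⟩, ⟨D₁, h₁⟩, ⟨D₂, h₂⟩⟩ := X
          rw [Finset.mem_powerset] at hA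
          refine ⟨fun δ hδ => ?_, fun p hp => ?_⟩
          · rcases Finset.mem_union.1 hδ with hδ | hδ
            · exact ⟨Or.inl (h₁.1 δ hδ).1, (h₁.1 δ hδ).2.trans hA⟩
            · exact ⟨Or.inr (h₂.1 δ hδ).1, (h₂.1 δ hδ).2.trans Finset.sdiff_subset⟩
          · by_cases hpA : p ∈ A
            · obtain ⟨δ, ⟨hδ, hpδ⟩, hu⟩ := h₁.2 p hpA
              refine ⟨δ, ⟨Finset.mem_union_left _ hδ, hpδ⟩, fun ε hε => ?_⟩
              rcases Finset.mem_union.1 hε.1 with h | h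
              · exact hu ε ⟨h, hε.2⟩
              · exact absurd hpA (Finset.mem_sdiff.1 ((h₂.1 ε h).2 hε.2)).2
            · obtain ⟨δ, ⟨hδ, hpδ⟩, hu⟩ := h₂.2 p (Finset.mem_sdiff.2 ⟨hp, hpA⟩)
              refine ⟨δ, ⟨Finset.mem_union_right _ hδ, hpδ⟩, fun ε hε => ?_⟩
              rcases Finset.mem_union.1 hε.1 with h | h
              · exact absurd ((h₁.1 ε h).2 hε.2) hpA
              · exact hu ε ⟨h, hε.2⟩⟩
      left_inv := by
        rintro ⟨D, hD⟩
        ext δ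
        simp only [Finset.mem_union, Finset.mem_filter]
        constructor
        · tauto
        · intro h
          rcases (hD.1 δ h).1 with h' | h' <;> tauto
      right_inv := by
        rintro ⟨⟨A, hA⟩, ⟨D₁, h₁⟩, ⟨D₂, h₂⟩⟩
        have e₁ : (D₁ ∪ D₂).filter (· ∈ E₁) = D₁ := by
          ext δ
          simp only [Finset.mem_union, Finset.mem_filter]
          constructor
          · rintro ⟨h | h, h'⟩
            · exact h
            · exact (hE' δ h' (h₂.1 δ h).1).elim
          · exact fun h => ⟨Or.inl h, (h₁.1 δ h).1⟩
        have e₂ : (D₁ ∪ D₂).filter (· ∈ E₂) = D₂ := by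
          ext δ
          simp only [Finset.mem_union, Finset.mem_filter]
          constructor
          · rintro ⟨h | h, h'⟩
            · exact (hE' δ (h₁.1 δ h).1 h').elim
            · exact h
          · exact fun h => ⟨Or.inr h, (h₂.1 δ h).1⟩
        have e₃ : D₁.biUnion id = A := by
          ext p
          simp only [Finset.mem_biUnion, id]
          constructor
          · rintro ⟨δ, hδ, hp⟩
            exact (h₁.1 δ hδ).2 hp
          · intro hp
            obtain ⟨δ, hδ, -⟩ := h₁.2 p hp
            exact ⟨δ, hδ⟩
        have e₄ : ((D₁ ∪ D₂).filter (· ∈ E₁)).biUnion id = A := by rw [e₁, e₃]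
        subst e₄
        refine Sigma.ext rfl (heq_of_eq (Prod.ext (Subtype.ext ?_) (Subtype.ext ?_)))
        · exact e₁
        · exact e₂ }
  unfold numExactCovers
  have := finite_isExactCover E₁
  have := finite_isExactCover E₂
  rw [Nat.card_congr key, Nat.card_sigma]
  simp only [Nat.card_prod]
  exact Finset.sum_coe_sort G.powerset fun A => Nat.card {D // IsExactCover E₁ A D} *
    Nat.card {D // IsExactCover E₂ (G \ A) D}

/-- Summing over the block that contains a given element. -/
theorem numExactCovers_peel [DecidableEq α] {q : α} (hq : q ∈ G) (hE : ∀ δ ∈ E, δ.Nonempty)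
    (F : Finset (Finset α)) (hF : ∀ δ, δ ∈ F ↔ δ ⊆ G ∧ δ ∈ E ∧ q ∈ δ) :
    numExactCovers E G = ∑ δ ∈ F, numExactCovers E (G \ δ) := by
  have hins : ∀ X : Σ δ : F, {D : Finset (Finset α) // IsExactCover E (G \ δ.1) D},
      IsExactCover E G (insert X.1.1 X.2.1) := by
    rintro ⟨⟨δ, hδ⟩, D, hD⟩
    obtain ⟨hδG, hδE, hqδ⟩ := (hF δ).1 hδ
    refine ⟨fun ε hε => ?_, fun p hp => ?_⟩
    · rcases Finset.mem_insert.1 hε with rfl | hε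
      · exact ⟨hδE, hδG⟩
      · exact ⟨(hD.1 ε hε).1, (hD.1 ε hε).2.trans Finset.sdiff_subset⟩
    · by_cases hpδ : p ∈ δ
      · refine ⟨δ, ⟨Finset.mem_insert_self _ _, hpδ⟩, fun ε hε => ?_⟩
        rcases Finset.mem_insert.1 hε.1 with h | h
        · exact h
        · exact absurd hpδ (Finset.mem_sdiff.1 ((hD.1 ε h).2 hε.2)).2
      · obtain ⟨ε, ⟨hε, hpε⟩, hu⟩ := hD.2 p (Finset.mem_sdiff.2 ⟨hp, hpδ⟩)
        refine ⟨ε, ⟨Finset.mem_insert_of_mem hε, hpε⟩, fun ε' hε' => ?_⟩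
        rcases Finset.mem_insert.1 hε'.1 with h | h
        · subst h
          exact absurd hε'.2 hpδ
        · exact hu ε' ⟨h, hε'.2⟩
  have hnot : ∀ X : Σ δ : F, {D : Finset (Finset α) // IsExactCover E (G \ δ.1) D},
      X.1.1 ∉ X.2.1 := by
    rintro ⟨⟨δ, hδ⟩, D, hD⟩ h
    obtain ⟨p, hp⟩ := hE δ ((hF δ).1 hδ).2.1
    exact (Finset.mem_sdiff.1 ((hD.1 δ h).2 hp)).2 hp
  have key : Function.Bijective (fun X : Σ δ : F,
      {D : Finset (Finset α) // IsExactCover E (G \ δ.1) D} =>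
      (⟨insert X.1.1 X.2.1, hins X⟩ : {D : Finset (Finset α) // IsExactCover E G D})) := by
    constructor
    · intro X X' h
      have h' : insert X.1.1 X.2.1 = insert X'.1.1 X'.2.1 := congrArg Subtype.val h
      have e : X.1.1 = X'.1.1 := (hins X).eq_of_mem (p := q) (Finset.mem_insert_self _ _)
        (h' ▸ Finset.mem_insert_self _ _) ((hF _).1 X.1.2).2.2 ((hF _).1 X'.1.2).2.2
      have hX := hnot X
      have hX' := hnot X'
      obtain ⟨⟨δ, hδ⟩, D, hD⟩ := X
      obtain ⟨⟨δ', hδ'⟩, D', hD'⟩ := X'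
      obtain rfl : δ = δ' := e
      refine Sigma.ext rfl (heq_of_eq (Subtype.ext ?_))
      have := congrArg (fun s => s.erase δ) h'
      simpa only [Finset.erase_insert hX, Finset.erase_insert hX'] using this
    · rintro ⟨D, hD⟩
      obtain ⟨δ, ⟨hδ, hqδ⟩, -⟩ := hD.2 q hq
      refine ⟨⟨⟨δ, (hF δ).2 ⟨(hD.1 δ hδ).2, (hD.1 δ hδ).1, hqδ⟩⟩, D.erase δ, ?_⟩,
        Subtype.ext (Finset.insert_erase hδ)⟩
      refine ⟨fun ε hε => ?_, fun p hp => ?_⟩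
      · obtain ⟨hne, hε⟩ := Finset.mem_erase.1 hε
        refine ⟨(hD.1 ε hε).1, fun p hp => Finset.mem_sdiff.2 ⟨(hD.1 ε hε).2 hp, ?_⟩⟩
        exact fun h' => hne (hD.eq_of_mem hε hδ hp h')
      · rw [Finset.mem_sdiff] at hp
        obtain ⟨ε, ⟨hε, hpε⟩, hu⟩ := hD.2 p hp.1
        exact ⟨ε, ⟨Finset.mem_erase.2 ⟨fun h' => hp.2 (h' ▸ hpε), hε⟩, hpε⟩,
          fun ε' hε' => hu ε' ⟨(Finset.mem_erase.1 hε'.1).2, hε'.2⟩⟩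
  unfold numExactCovers
  have := finite_isExactCover E
  rw [← Nat.card_congr (Equiv.ofBijective _ key), Nat.card_sigma]
  exact Finset.sum_coe_sort F fun δ => Nat.card {D // IsExactCover E (G \ δ) D}

/-- Exact covers are transported along an embedding. -/
theorem numExactCovers_map {β : Type*} (f : α ↪ β) (E : Set (Finset α)) (G : Finset α) :
    numExactCovers (Finset.map f '' E) (G.map f) = numExactCovers E G := by
  classical
  set F : Finset α ↪ Finset β := (Finset.mapEmbedding f).toEmbedding with hF
  have hFv : ∀ δ, F δ = δ.map f := fun δ => rfl
  have hp : ∀ (p : α) (s : Finset α), f p ∈ s.map f ↔ p ∈ s := fun p s => Finset.mem_map' f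
  have hiff : ∀ D : Finset (Finset α), IsExactCover (Finset.map f '' E) (G.map f) (D.map F) ↔
      IsExactCover E G D := by
    intro D
    unfold IsExactCover
    simp only [Finset.forall_mem_map, hFv, Finset.map_subset_map,
      (Finset.map_injective f).mem_set_image]
    refine and_congr_right fun _ => forall₂_congr fun p hpG => ?_
    constructor
    · rintro ⟨ε, ⟨hε, hpε⟩, hu⟩
      obtain ⟨δ, hδ, rfl⟩ := Finset.mem_map.1 hε
      refine ⟨δ, ⟨hδ, (hp p δ).1 hpε⟩, fun δ' hδ' => F.injective ?_⟩
      exact hu _ ⟨Finset.mem_map_of_mem F hδ'.1, (hp p δ').2 hδ'.2⟩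
    · rintro ⟨δ, ⟨hδ, hpδ⟩, hu⟩
      refine ⟨F δ, ⟨Finset.mem_map_of_mem F hδ, (hp p δ).2 hpδ⟩, ?_⟩
      rintro ε ⟨hε, hpε⟩
      obtain ⟨δ', hδ', rfl⟩ := Finset.mem_map.1 hε
      exact congrArg F (hu _ ⟨hδ', (hp p δ').1 hpε⟩)
  symm
  refine Nat.card_congr (Equiv.ofBijective (fun D => ⟨D.1.map F, (hiff D.1).2 D.2⟩) ⟨?_, ?_⟩)
  · intro D D' h
    exact Subtype.ext (Finset.map_injective F (congrArg Subtype.val h))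
  · rintro ⟨D', hD'⟩
    have hsub : ∃ D : Finset (Finset α), D.map F = D' := by
      refine ⟨D'.preimage F F.injective.injOn, ?_⟩
      rw [Finset.map_eq_image, Finset.image_preimage, Finset.filter_true_of_mem]
      intro δ hδ
      obtain ⟨ε, -, rfl⟩ := (hD'.1 δ hδ).1
      exact ⟨ε, rfl⟩
    obtain ⟨D, rfl⟩ := hsub
    exact ⟨⟨D, (hiff D).1 hD'⟩, rfl⟩

end ExactCover

/-! ### Complementation along cells -/

/-- The edges of the four-cycle on `Fin 4`. -/
def cycleEdges : Finset (Finset (Fin 4)) := Finset.univ.image fun i => {i, i + 1}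

theorem numExactCovers_cycleEdges (A : Finset (Fin 4)) :
    numExactCovers (cycleEdges : Set (Finset (Fin 4))) A =
      (cycleEdges.powerset.filter fun D => (∀ δ ∈ D, δ ⊆ A) ∧
        ∀ p ∈ A, ∃ δ ∈ D, p ∈ δ ∧ ∀ ε ∈ D, p ∈ ε → ε = δ).card := by
  unfold numExactCovers
  rw [← Nat.card_eq_finsetCard]
  refine Nat.card_congr (Equiv.subtypeEquivRight fun D => ?_)
  rw [Finset.mem_filter, Finset.mem_powerset]
  constructor
  · refine fun h => ⟨fun δ hδ => (h.1 δ hδ).1, fun δ hδ => (h.1 δ hδ).2, fun p hp => ?_⟩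
    obtain ⟨δ, ⟨hδ, hpδ⟩, hu⟩ := h.2 p hp
    exact ⟨δ, hδ, hpδ, fun ε hε hpε => hu ε ⟨hε, hpε⟩⟩
  · rintro ⟨h₁, h₂, h₃⟩
    refine ⟨fun δ hδ => ⟨h₁ hδ, h₂ δ hδ⟩, fun p hp => ?_⟩
    obtain ⟨δ, hδ, hpδ, hu⟩ := h₃ p hp
    exact ⟨δ, ⟨hδ, hpδ⟩, fun ε hε => hu ε hε.1 hε.2⟩

/-- The empty set and a pair of adjacent vertices have one matching each, the whole cycle has two,
and all other sets have none. The weight `2 ^ (A.card / 2)` makes up for the asymmetry between the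
empty set and the whole cycle. -/
theorem numExactCovers_cycleEdges_compl (A : Finset (Fin 4)) :
    numExactCovers (cycleEdges : Set (Finset (Fin 4))) Aᶜ * 2 ^ (A.card / 2) =
      2 * numExactCovers (cycleEdges : Set (Finset (Fin 4))) A := by
  simp only [numExactCovers_cycleEdges]
  revert A
  decide +kernel

theorem numExactCovers_cycleEdges_odd (A : Finset (Fin 4)) (hA : Odd A.card) :
    numExactCovers (cycleEdges : Set (Finset (Fin 4))) A = 0 := by
  simp only [numExactCovers_cycleEdges]
  revert A
  decide +kernel

/-- The four neighbours of the cell `c`, in cyclic order. -/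
def cellCorner (c : ℤ × ℤ) : Fin 4 ↪ ℤ × ℤ where
  toFun := ![(c.1 + 1, c.2), (c.1, c.2 + 1), (c.1 - 1, c.2), (c.1, c.2 - 1)]
  inj' := by
    intro i j
    fin_cases i <;> fin_cases j <;> simp [Prod.ext_iff] <;> omega

theorem forall_cellCorner (c : ℤ × ℤ) : cellCorner c 0 = (c.1 + 1, c.2) ∧
    cellCorner c 1 = (c.1, c.2 + 1) ∧ cellCorner c 2 = (c.1 - 1, c.2) ∧
    cellCorner c 3 = (c.1, c.2 - 1) := ⟨rfl, rfl, rfl, rfl⟩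

/-- The four squares around the cell `c`. -/
def cellSquares (c : ℤ × ℤ) : Finset (ℤ × ℤ) := Finset.univ.map (cellCorner c)

/-- The four dominoes around the cell `c`. -/
def cellDominoes (c : ℤ × ℤ) : Set (Finset (ℤ × ℤ)) :=
  Finset.map (cellCorner c) '' (cycleEdges : Set (Finset (Fin 4)))

theorem mem_cellSquares {c v : ℤ × ℤ} : v ∈ cellSquares c ↔
    (v.2 = c.2 ∧ (v.1 = c.1 + 1 ∨ v.1 = c.1 - 1)) ∨
      (v.1 = c.1 ∧ (v.2 = c.2 + 1 ∨ v.2 = c.2 - 1)) := by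
  obtain ⟨h₀, h₁, h₂, h₃⟩ := forall_cellCorner c
  have : v ∈ cellSquares c ↔ cellCorner c 0 = v ∨ cellCorner c 1 = v ∨ cellCorner c 2 = v ∨
      cellCorner c 3 = v := by
    simp [cellSquares, Fin.exists_fin_succ]
  rw [this, h₀, h₁, h₂, h₃]
  simp only [Prod.ext_iff]
  omega

theorem mem_cellDominoes {c : ℤ × ℤ} {δ : Finset (ℤ × ℤ)} : δ ∈ cellDominoes c ↔
    ∃ x y : ℤ, (x = c.1 + 1 ∨ x = c.1 - 1) ∧ (y = c.2 + 1 ∨ y = c.2 - 1) ∧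
      δ = {(x, c.2), (c.1, y)} := by
  obtain ⟨h₀, h₁, h₂, h₃⟩ := forall_cellCorner c
  have : δ ∈ cellDominoes c ↔ ({cellCorner c 0, cellCorner c 1} = δ ∨
      {cellCorner c 1, cellCorner c 2} = δ ∨ {cellCorner c 2, cellCorner c 3} = δ ∨
      {cellCorner c 3, cellCorner c 0} = δ) := by
    simp [cellDominoes, cycleEdges, Fin.exists_fin_succ, Finset.map_insert]
  rw [this, h₀, h₁, h₂, h₃]
  constructor
  · rintro (rfl | rfl | rfl | rfl)
    · exact ⟨_, _, Or.inl rfl, Or.inl rfl, rfl⟩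
    · exact ⟨_, _, Or.inr rfl, Or.inl rfl, Finset.pair_comm _ _⟩
    · exact ⟨_, _, Or.inr rfl, Or.inr rfl, rfl⟩
    · exact ⟨_, _, Or.inl rfl, Or.inr rfl, Finset.pair_comm _ _⟩
  · rintro ⟨x, y, rfl | rfl, rfl | rfl, rfl⟩
    · exact Or.inl rfl
    · exact Or.inr (Or.inr (Or.inr (Finset.pair_comm _ _)))
    · exact Or.inr (Or.inl (Finset.pair_comm _ _))
    · exact Or.inr (Or.inr (Or.inl rfl))

theorem subset_cellSquares {c : ℤ × ℤ} {δ : Finset (ℤ × ℤ)} (h : δ ∈ cellDominoes c) :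
    δ ⊆ cellSquares c := by
  obtain ⟨ε, -, rfl⟩ := h
  exact Finset.map_subset_map.2 (Finset.subset_univ _)

theorem numExactCovers_cellDominoes_compl (c : ℤ × ℤ) {A : Finset (ℤ × ℤ)}
    (hA : A ⊆ cellSquares c) :
    numExactCovers (cellDominoes c) (cellSquares c \ A) * 2 ^ (A.card / 2) =
      2 * numExactCovers (cellDominoes c) A := by
  obtain ⟨B, -, rfl⟩ := Finset.subset_map_iff.1 hA
  rw [cellSquares, ← Finset.map_sdiff, ← Finset.compl_eq_univ_sdiff, cellDominoes,
    numExactCovers_map, numExactCovers_map, Finset.card_map, numExactCovers_cycleEdges_compl]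

theorem numExactCovers_cellDominoes_odd (c : ℤ × ℤ) {A : Finset (ℤ × ℤ)}
    (hA : A ⊆ cellSquares c) (h : Odd A.card) :
    numExactCovers (cellDominoes c) A = 0 := by
  obtain ⟨B, -, rfl⟩ := Finset.subset_map_iff.1 hA
  rw [Finset.card_map] at h
  rw [cellDominoes, numExactCovers_map, numExactCovers_cycleEdges_odd B h]

/-- Two distinct cells that share a domino are diagonal neighbours, so both of their coordinates
differ by one; equal parities exclude this. -/
theorem cellDominoes_disjoint {c c' : ℤ × ℤ} (hne : c ≠ c') (h₁ : Even (c.1 - c'.1))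
    (h₂ : Even (c.2 - c'.2)) : Disjoint (cellDominoes c) (cellDominoes c') := by
  rw [Set.disjoint_left]
  intro δ h h'
  obtain ⟨x, y, hx, hy, rfl⟩ := mem_cellDominoes.1 h
  obtain ⟨x', y', hx', hy', he⟩ := mem_cellDominoes.1 h'
  have e₁ : ((x, c.2) : ℤ × ℤ) ∈ ({(x', c'.2), (c'.1, y')} : Finset (ℤ × ℤ)) := by
    rw [← he]; simp
  have e₂ : ((c.1, y) : ℤ × ℤ) ∈ ({(x', c'.2), (c'.1, y')} : Finset (ℤ × ℤ)) := by
    rw [← he]; simp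
  simp only [Finset.mem_insert, Finset.mem_singleton, Prod.mk.injEq] at e₁ e₂
  obtain ⟨k, hk⟩ := h₁
  obtain ⟨l, hl⟩ := h₂
  apply hne
  ext <;> omega

open Classical in
-- Only squares around `c` can be covered by its dominoes. Indexing by subsets of the cell rather
-- than of `G` gives two regions the same index set, on which complementation acts.
theorem numExactCovers_cell_union (c : ℤ × ℤ) {E : Set (Finset (ℤ × ℤ))}
    (hE : Disjoint (cellDominoes c) E) (G : Finset (ℤ × ℤ)) :
    numExactCovers (cellDominoes c ∪ E) G = ∑ A ∈ (cellSquares c).powerset,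
      if A ⊆ G then numExactCovers (cellDominoes c) A * numExactCovers E (G \ A) else 0 := by
  rw [numExactCovers_union hE, ← Finset.sum_filter]
  symm
  refine Finset.sum_subset_zero_on_sdiff (fun A hA => ?_) (fun A hA => ?_) (fun A _ => rfl)
  · exact Finset.mem_powerset.2 (Finset.mem_filter.1 hA).2
  · rw [Finset.mem_sdiff, Finset.mem_powerset, Finset.mem_filter, Finset.mem_powerset] at hA
    obtain ⟨v, hv, hv'⟩ := Finset.not_subset.1 fun h => hA.2 ⟨h, hA.1⟩
    rw [numExactCovers_eq_zero hv fun δ hδ hvδ _ => hv' (subset_cellSquares hδ hvδ), zero_mul]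

/-- The bookkeeping for one square `v` when a cell is removed: `p`, `q`, `V`, `A` stand for `v`
lying in `G`, in `G'`, in the cell and in `A`. A square of the cell loses one cell and leaves
exactly one of the two regions. -/
theorem eq_ite_add_ite_of_add_ite_eq {p q V A : Prop} [Decidable p] [Decidable q] [Decidable V]
    [Decidable A] {n : ℕ}
    (h : n + (if V then 1 else 0) = (if p then 1 else 0) + (if q then 1 else 0))
    (h₁ : V ∧ ¬ A → p) (h₂ : A → q) (h₃ : A → V) :
    n = (if p ∧ ¬ (V ∧ ¬ A) then 1 else 0) + (if q ∧ ¬ A then 1 else 0) := by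
  by_cases p <;> by_cases q <;> by_cases V <;> by_cases A <;> simp_all

/-- **Complementation.** If every square belongs to as many cells of `C` as there are regions
among `G` and `G'` containing it, then the numbers of tilings of `G` and `G'` by dominoes around
the cells of `C` are the same up to a power of two. -/
theorem numExactCovers_complementation (C : Finset (ℤ × ℤ))
    (hpar : ∀ c ∈ C, ∀ c' ∈ C, Even (c.1 - c'.1) ∧ Even (c.2 - c'.2)) :
    ∀ G G' : Finset (ℤ × ℤ),
      (∀ v, (C.filter fun c => v ∈ cellSquares c).card =
        (if v ∈ G then 1 else 0) + (if v ∈ G' then 1 else 0)) →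
      numExactCovers (⋃ c ∈ C, cellDominoes c) G * 2 ^ (G'.card / 2) =
        2 ^ C.card * numExactCovers (⋃ c ∈ C, cellDominoes c) G' := by
  induction C using Finset.induction_on with
  | empty =>
    intro G G' h
    have hG : G = ∅ := Finset.eq_empty_iff_forall_notMem.2 fun v hv => by
      have := h v
      simp [hv] at this
      omega
    have hG' : G' = ∅ := Finset.eq_empty_iff_forall_notMem.2 fun v hv => by
      have := h v
      simp [hv] at this
    subst hG hG'
    simp
  | insert c C hc ih =>
    intro G G' h
    have ih := ih fun c₁ h₁ c₂ h₂ =>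
      hpar c₁ (Finset.mem_insert_of_mem h₁) c₂ (Finset.mem_insert_of_mem h₂)
    set E : Set (Finset (ℤ × ℤ)) := ⋃ c ∈ C, cellDominoes c with hEdef
    -- The parity hypothesis enters only here: no domino belongs to two cells.
    have hdisj : Disjoint (cellDominoes c) E := by
      rw [hEdef, Set.disjoint_iUnion₂_right]
      intro c' hc'
      have := hpar c (Finset.mem_insert_self _ _) c' (Finset.mem_insert_of_mem hc')
      exact cellDominoes_disjoint (fun e => hc (e ▸ hc')) this.1 this.2
    have hcount : ∀ v, (C.filter fun c => v ∈ cellSquares c).card +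
        (if v ∈ cellSquares c then 1 else 0) =
        (if v ∈ G then 1 else 0) + (if v ∈ G' then 1 else 0) := by
      intro v
      rw [← h v, Finset.filter_insert]
      split_ifs with hv
      · rw [Finset.card_insert_of_notMem fun h => hc (Finset.mem_filter.1 h).1]
      · rfl
    have hzero : ∀ v H, v ∈ H → (C.filter fun c => v ∈ cellSquares c).card = 0 →
        numExactCovers E H = 0 := by
      intro v H hv h0
      refine numExactCovers_eq_zero hv fun δ hδ hvδ _ => ?_
      obtain ⟨c', hc', hδ⟩ := Set.mem_iUnion₂.1 hδ
      exact Finset.notMem_empty c' (Finset.card_eq_zero.1 h0 ▸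
        Finset.mem_filter.2 ⟨hc', subset_cellSquares hδ hvδ⟩)
    rw [Finset.set_biUnion_insert, numExactCovers_cell_union c hdisj,
      numExactCovers_cell_union c hdisj, Finset.card_insert_of_notMem hc]
    -- On the side of `G` the sum is reindexed by complements in the cell, so that the part `A`
    -- covered in `G'` faces `cellSquares c \ A` in `G`.
    rw [Finset.sum_nbij' (t := (cellSquares c).powerset) (g := fun A =>
      if cellSquares c \ A ⊆ G then numExactCovers (cellDominoes c) (cellSquares c \ A) *
        numExactCovers E (G \ (cellSquares c \ A)) else 0)
      (fun A => cellSquares c \ A) (fun A => cellSquares c \ A)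
      (by simp) (by simp) (fun A hA => by simp [Finset.inter_eq_right.2 (Finset.mem_powerset.1 hA)])
      (fun A hA => by simp [Finset.inter_eq_right.2 (Finset.mem_powerset.1 hA)])
      (fun A hA => by simp [Finset.inter_eq_right.2 (Finset.mem_powerset.1 hA)]),
      Finset.sum_mul, Finset.mul_sum]
    refine Finset.sum_congr rfl fun A hA => ?_
    rw [Finset.mem_powerset] at hA
    by_cases h₁ : cellSquares c \ A ⊆ G
    · by_cases h₂ : A ⊆ G'
      · rw [if_pos h₁, if_pos h₂]
        rcases Nat.even_or_odd A.card with hev | hodd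
        · have ih := ih (G \ (cellSquares c \ A)) (G' \ A) fun v => by
            have h₁ := @h₁ v
            simp only [Finset.mem_sdiff] at h₁ ⊢
            exact eq_ite_add_ite_of_add_ite_eq (hcount v) h₁ (@h₂ v) (@hA v)
          -- Halving is additive here because `A` has even cardinality; odd sets have no matching
          -- and are treated apart.
          have hexp : G'.card / 2 = A.card / 2 + (G' \ A).card / 2 := by
            have := Finset.card_sdiff_add_card_eq_card h₂
            obtain ⟨r, hr⟩ := hev
            omega
          rw [hexp, pow_add, pow_succ]
          calc _ = (numExactCovers (cellDominoes c) (cellSquares c \ A) * 2 ^ (A.card / 2)) *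
                (numExactCovers E (G \ (cellSquares c \ A)) * 2 ^ ((G' \ A).card / 2)) := by ring
            _ = _ := by rw [ih, numExactCovers_cellDominoes_compl c hA]; ring
        · have z := numExactCovers_cellDominoes_odd c hA hodd
          have z' := numExactCovers_cellDominoes_compl c hA
          rw [z, mul_zero, mul_eq_zero] at z'
          rw [z, z'.resolve_right (by positivity)]
          simp
      · rw [if_neg h₂, if_pos h₁]
        -- A square of `A` outside `G'` must lie in `G` and in no cell other than `c`. It then
        -- remains in `G` after the removal, with no domino left to cover it, so the term for `G`
        -- vanishes too.
        obtain ⟨v, hv, hv'⟩ := Finset.not_subset.1 h₂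
        have := hcount v
        rw [if_pos (hA hv), if_neg hv'] at this
        have hvG : v ∈ G := by
          by_contra hvG
          rw [if_neg hvG] at this
          omega
        rw [if_pos hvG] at this
        rw [hzero v (G \ (cellSquares c \ A)) (by simp [hvG, hv]) (by omega)]
        simp
    · rw [if_neg h₁]
      split_ifs with h₂
      · obtain ⟨v, hv, hv'⟩ := Finset.not_subset.1 h₁
        rw [Finset.mem_sdiff] at hv
        have := hcount v
        rw [if_pos hv.1, if_neg hv'] at this
        have hvG : v ∈ G' := by
          by_contra hvG
          rw [if_neg hvG] at this
          omega
        rw [if_pos hvG] at this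
        rw [hzero v (G' \ A) (by simp [hvG, hv.2]) (by omega)]
        simp
      · simp

/-! ### Aztec rectangles with windows -/

theorem mem_translateRegion {S : Finset (ℤ × ℤ)} {v p : ℤ × ℤ} :
    p ∈ translateRegion S v ↔ p - v ∈ S := by
  simp only [translateRegion, Finset.mem_map, addRightEmbedding_apply]
  constructor
  · rintro ⟨q, hq, rfl⟩
    simpa using hq
  · intro h
    exact ⟨p - v, h, by simp⟩

theorem card_translateRegion (S : Finset (ℤ × ℤ)) (v : ℤ × ℤ) :
    (translateRegion S v).card = S.card := Finset.card_map _

/-- Membership in the outer Aztec rectangle of half-extension `k`. -/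
def InOuter (m n k : ℤ) (p : ℤ × ℤ) : Prop :=
  (-k ≤ p.1 ∧ p.1 ≤ 2 * n + k ∧ -k ≤ p.2 ∧ p.2 ≤ 2 * m + k) ∧ (p.1 + p.2) % 2 = 1

/-- Membership in the window of height parameter `k` centered at `d / 2`. -/
def InWindow (m k a d : ℤ) (p : ℤ × ℤ) : Prop :=
  (d - 1 - (a - k) ≤ p.1 ∧ p.1 ≤ d - 1 + (a - k) ∧ m - k ≤ p.2 ∧ p.2 ≤ m + k) ∧
    (p.1 + p.2) % 2 = 1

/-- A cell of the outer Aztec rectangle. -/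
def OuterCell (m n k : ℤ) (c : ℤ × ℤ) : Prop :=
  (-k ≤ c.1 ∧ c.1 ≤ 2 * n + k ∧ -k ≤ c.2 ∧ c.2 ≤ 2 * m + k) ∧
    (c.1 + k) % 2 = 0 ∧ (c.2 + k) % 2 = 0

/-- A cell of a window. -/
def WindowCell (m k a d : ℤ) (c : ℤ × ℤ) : Prop :=
  (d - 1 - (a - k - 1) ≤ c.1 ∧ c.1 ≤ d - 1 + (a - k - 1) ∧ m - k - 1 ≤ c.2 ∧
    c.2 ≤ m + k + 1) ∧ (c.1 + k) % 2 = 0 ∧ (c.2 + k) % 2 = 0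

open Classical in
/-- The cells along which the complementation from windows of height `k + 1` to windows of height
`k` takes place. -/
noncomputable def windowCells (m k : ℕ) {s : ℕ} (a : Fin s → ℕ) (d : Fin s → ℤ) :
    Finset (ℤ × ℤ) :=
  (Finset.Icc (-k : ℤ) (2 * (m + ∑ i, (a i + 1) : ℕ) + k) ×ˢ
    Finset.Icc (-k : ℤ) (2 * m + k)).filter fun c =>
      OuterCell m (m + ∑ i, (a i + 1) : ℕ) k c ∧ ∀ i, ¬ WindowCell m k (a i) (d i) c

theorem mem_windowCells {m k s : ℕ} {a : Fin s → ℕ} {d : Fin s → ℤ} {c : ℤ × ℤ} :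
    c ∈ windowCells m k a d ↔ OuterCell m (m + ∑ i, (a i + 1) : ℕ) k c ∧
      ∀ i, ¬ WindowCell m k (a i) (d i) c := by
  simp only [windowCells, Finset.mem_filter, Finset.mem_product, Finset.mem_Icc,
    and_iff_right_iff_imp]
  rintro ⟨⟨h, -⟩, -⟩
  tauto

theorem mem_translate_aztecRect {m n k : ℕ} {p : ℤ × ℤ} :
    p ∈ translateRegion (aztecRect (m + k) (n + k)) (-k, -k) ↔ InOuter m n k p := by
  simp only [mem_translateRegion, aztecRect, Finset.mem_filter, Finset.mem_product,
    Finset.mem_Icc, InOuter, Int.odd_iff, Prod.fst_sub, Prod.snd_sub]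
  push_cast
  omega

/-- The translation vector has coordinate sum `d - a + m - 1`, which is odd, so the black squares of
the odd rectangle land on squares of the colour of the frame. -/
theorem mem_oddWindow {m k a : ℕ} {d : ℤ} (hm : Even m) (hk : k ≤ a) (hd : Even (d - a))
    {p : ℤ × ℤ} : p ∈ oddWindow m k (a - k) d ↔ InWindow m k a d p := by
  simp only [oddWindow, mem_translateRegion, oddAztecRect, Finset.mem_filter, Finset.mem_product,
    Finset.mem_Icc, InWindow, Int.even_iff, Prod.fst_sub, Prod.snd_sub]
  rw [Int.even_iff] at hd
  rw [Nat.even_iff] at hm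
  omega

theorem mem_aztecRectWithWindows {m k s : ℕ} {a : Fin s → ℕ} {d : Fin s → ℤ} (hm : Even m)
    (hka : ∀ i, k ≤ a i) (hparity : ∀ i, Even (d i - a i)) {p : ℤ × ℤ} :
    p ∈ aztecRectWithWindows m k a d ↔ InOuter m (m + ∑ i, (a i + 1) : ℕ) k p ∧
      ∀ i, ¬ InWindow m k (a i) (d i) p := by
  rw [aztecRectWithWindows, add_right_comm m k, Finset.mem_sdiff, mem_translate_aztecRect]
  simp only [Finset.mem_biUnion, Finset.mem_univ, true_and, not_exists]
  refine and_congr_right fun _ => forall_congr' fun i => ?_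
  rw [mem_oddWindow hm (hka i) (hparity i)]

theorem centeredRun_subset_iff {a : ℕ} {d : ℤ} (hd : Even (d - a)) {n : ℕ} :
    centeredRun a d ⊆ Finset.Icc (1 : ℤ) n ↔ a + 2 ≤ d ∧ d + a ≤ 2 * n := by
  rw [Int.even_iff] at hd
  rw [centeredRun, Finset.Icc_subset_Icc_iff (by omega)]
  omega

theorem disjoint_centeredRun_iff {a a' : ℕ} {d d' : ℤ} (hd : Even (d - a)) (hd' : Even (d' - a')) :
    Disjoint (centeredRun a d) (centeredRun a' d') ↔ d + a + 2 ≤ d' - a' ∨ d' + a' + 2 ≤ d - a := by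
  rw [Int.even_iff] at hd hd'
  simp only [centeredRun, Finset.disjoint_left, Finset.mem_Icc]
  constructor
  · intro h
    by_contra hc
    rcases le_total ((d - a) / 2) ((d' - a') / 2) with hle | hle
    · exact @h ((d' - a') / 2) (by omega) (by omega)
    · exact @h ((d - a) / 2) (by omega) (by omega)
  · intro h x hx hx'
    omega

/-- Since the windows are disjoint and lie in the outer rectangle, indicators subtract, and
incidences can be counted for each rectangle separately. -/
theorem ite_and_forall_not {ι : Type*} [Fintype ι] {P : Prop} {W : ι → Prop} [Decidable P]
    [∀ i, Decidable (W i)] [Decidable (P ∧ ∀ i, ¬ W i)] (hP : ∀ i, W i → P)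
    (hW : ∀ i j, W i → W j → i = j) :
    (if P ∧ ∀ i, ¬ W i then 1 else 0 : ℤ) = (if P then 1 else 0) - ∑ i, if W i then 1 else 0 := by
  by_cases h : ∃ i, W i
  · obtain ⟨i, hi⟩ := h
    rw [Finset.sum_eq_single i (fun j _ hj => if_neg fun h => hj (hW j i h hi)) (by simp),
      if_pos hi, if_pos (hP i hi), if_neg fun h => h.2 i hi]
    rfl
  · push Not at h
    rw [Finset.sum_eq_zero fun i _ => if_neg (h i)]
    simp [h]

open Classical in
-- For a square of the right colour exactly two of the four neighbours, opposite to each other, have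
-- the parity of a cell. Both are cells if `v` lies in the smaller rectangle, and only one if `v`
-- lies on the border added by the larger one.
theorem outerCell_count (m n k : ℕ) (v : ℤ × ℤ) :
    (if OuterCell m n k (v.1 + 1, v.2) then 1 else 0 : ℤ) +
      (if OuterCell m n k (v.1, v.2 + 1) then 1 else 0) +
      (if OuterCell m n k (v.1 - 1, v.2) then 1 else 0) +
      (if OuterCell m n k (v.1, v.2 - 1) then 1 else 0) =
    (if InOuter m n (k + 1 : ℕ) v then 1 else 0) + (if InOuter m n k v then 1 else 0) := by
  unfold OuterCell InOuter
  push_cast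
  rcases Int.emod_two_eq_zero_or_one (v.1 + k) with hx | hx <;>
  rcases Int.emod_two_eq_zero_or_one (v.2 + k) with hy | hy
  · split_ifs <;> omega
  · split_ifs <;> omega
  · split_ifs <;> omega
  · split_ifs <;> omega

open Classical in
-- The larger `k`, the taller and narrower the window. Its extreme columns at height `k` and its
-- extreme rows at height `k + 1` belong to one window only and touch one cell; the parities of `m`
-- and `d - a` align these borders with the cells.
theorem windowCell_count {m k a : ℕ} {d : ℤ} (hm : Even m) (hk : k + 1 ≤ a) (hd : Even (d - a))
    (v : ℤ × ℤ) :
    (if WindowCell m k a d (v.1 + 1, v.2) then 1 else 0 : ℤ) +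
      (if WindowCell m k a d (v.1, v.2 + 1) then 1 else 0) +
      (if WindowCell m k a d (v.1 - 1, v.2) then 1 else 0) +
      (if WindowCell m k a d (v.1, v.2 - 1) then 1 else 0) =
    (if InWindow m (k + 1 : ℕ) a d v then 1 else 0) + (if InWindow m k a d v then 1 else 0) := by
  rw [Int.even_iff] at hd
  rw [Nat.even_iff] at hm
  unfold WindowCell InWindow
  push_cast
  rcases Int.emod_two_eq_zero_or_one (v.1 + k) with hx | hx <;>
  rcases Int.emod_two_eq_zero_or_one (v.2 + k) with hy | hy
  · split_ifs <;> omega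
  · split_ifs <;> omega
  · split_ifs <;> omega
  · split_ifs <;> omega

theorem mem_cellSquares_comm {c v : ℤ × ℤ} : v ∈ cellSquares c ↔ c ∈ cellSquares v := by
  simp only [mem_cellSquares]
  omega

theorem card_filter_mem_cellSquares (C : Finset (ℤ × ℤ)) (v : ℤ × ℤ) :
    ((C.filter fun c => v ∈ cellSquares c).card : ℤ) =
      (if (v.1 + 1, v.2) ∈ C then 1 else 0) + (if (v.1, v.2 + 1) ∈ C then 1 else 0) +
      (if (v.1 - 1, v.2) ∈ C then 1 else 0) + (if (v.1, v.2 - 1) ∈ C then 1 else 0) := by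
  have : C.filter (fun c => v ∈ cellSquares c) = (cellSquares v).filter (· ∈ C) := by
    ext c
    simp only [Finset.mem_filter, mem_cellSquares_comm (c := c), and_comm]
  obtain ⟨h₀, h₁, h₂, h₃⟩ := forall_cellCorner v
  rw [this, Finset.card_filter, cellSquares, Finset.sum_map, Fin.sum_univ_four, h₀, h₁, h₂, h₃]
  push_cast
  rfl

theorem isDomino_of_mem_cellDominoes {c : ℤ × ℤ} {δ : Finset (ℤ × ℤ)} (h : δ ∈ cellDominoes c) :
    IsDomino δ := by
  obtain ⟨x, y, hx, hy, rfl⟩ := mem_cellDominoes.1 h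
  refine ⟨_, _, ⟨?_, ?_⟩, rfl⟩ <;> simp only [abs_eq (zero_le_one' ℤ)] <;> omega

/-- The domino on `(x, y)` and `(x', y')` lies around `(x, y')` and `(x', y)`. As `x + y` is odd,
exactly one of these has both coordinates congruent to `κ` mod 2. -/
theorem numDominoTilings_eq_of_cells {C G : Finset (ℤ × ℤ)} (κ : ℤ)
    (hodd : ∀ p ∈ G, Odd (p.1 + p.2))
    (hC : ∀ x y x' y' : ℤ, (x, y) ∈ G → (x', y') ∈ G → (x' = x + 1 ∨ x' = x - 1) →
      (y' = y + 1 ∨ y' = y - 1) → (x + κ) % 2 = 0 → (y' + κ) % 2 = 0 → (x, y') ∈ C) :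
    numDominoTilings G = numExactCovers (⋃ c ∈ C, cellDominoes c) G := by
  rw [numDominoTilings_eq_numExactCovers]
  refine numExactCovers_congr fun δ hδ => ?_
  simp only [Set.mem_ofPred_eq, Set.mem_iUnion₂]
  constructor
  · rintro ⟨⟨x, y⟩, ⟨x', y'⟩, ⟨hx, hy⟩, rfl⟩
    have hp : (x, y) ∈ G := hδ (by simp)
    have hq : (x', y') ∈ G := hδ (by simp)
    have o := Int.odd_iff.1 (hodd _ hp)
    rw [abs_eq zero_le_one] at hx hy
    simp only at hx hy o
    rcases Int.emod_two_eq_zero_or_one (x + κ) with h | h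
    · refine ⟨(x, y'), hC x y x' y' hp hq (by omega) (by omega) h (by omega),
        mem_cellDominoes.2 ⟨x', y, by simp; omega, by simp; omega, Finset.pair_comm _ _⟩⟩
    · refine ⟨(x', y), hC x' y' x y hq hp (by omega) (by omega) (by omega) (by omega),
        mem_cellDominoes.2 ⟨x, y', by simp; omega, by simp; omega, rfl⟩⟩
  · rintro ⟨c, -, h⟩
    exact isDomino_of_mem_cellDominoes h

/-! ### Numbers of squares -/

theorem card_aztecRect (m n : ℕ) : (aztecRect m n).card = m * (n + 1) + (m + 1) * n := by
  let f : ℕ × ℕ → ℤ × ℤ := fun p => (2 * p.1, 2 * p.2 + 1)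
  let g : ℕ × ℕ → ℤ × ℤ := fun p => (2 * p.1 + 1, 2 * p.2)
  have hf : Function.Injective f := fun p q h => by
    simp only [f, Prod.mk.injEq] at h
    ext <;> omega
  have hg : Function.Injective g := fun p q h => by
    simp only [g, Prod.mk.injEq] at h
    ext <;> omega
  have : aztecRect m n = (Finset.range (n + 1) ×ˢ Finset.range m).image f ∪
      (Finset.range n ×ˢ Finset.range (m + 1)).image g := by
    ext ⟨x, y⟩
    simp only [aztecRect, Finset.mem_filter, Finset.mem_product, Finset.mem_Icc, Int.odd_iff,
      Finset.mem_union, Finset.mem_image, Finset.mem_range, f, g, Prod.exists, Prod.mk.injEq]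
    constructor
    · intro h
      rcases Int.emod_two_eq_zero_or_one x with hx | hx
      · exact Or.inl ⟨(x / 2).toNat, (y / 2).toNat, by omega, by omega, by omega⟩
      · exact Or.inr ⟨(x / 2).toNat, (y / 2).toNat, by omega, by omega, by omega⟩
    · rintro (⟨i, j, h⟩ | ⟨i, j, h⟩) <;> omega
  rw [this, Finset.card_union_of_disjoint, Finset.card_image_of_injective _ hf,
    Finset.card_image_of_injective _ hg]
  · simp only [Finset.card_product, Finset.card_range]
    ring
  · simp only [Finset.disjoint_left, Finset.mem_image, f, g, Prod.exists, not_exists]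
    rintro ⟨x, y⟩ ⟨i, j, -, h⟩ i' j' ⟨-, h'⟩
    simp only [Prod.mk.injEq] at h h'
    omega

theorem card_oddAztecRect (m n : ℕ) :
    (oddAztecRect m n).card = m * n + (m + 1) * (n + 1) := by
  let f : ℕ × ℕ → ℤ × ℤ := fun p => (2 * p.1 + 1, 2 * p.2 + 1)
  let g : ℕ × ℕ → ℤ × ℤ := fun p => (2 * p.1, 2 * p.2)
  have hf : Function.Injective f := fun p q h => by
    simp only [f, Prod.mk.injEq] at h
    ext <;> omega
  have hg : Function.Injective g := fun p q h => by
    simp only [g, Prod.mk.injEq] at h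
    ext <;> omega
  have : oddAztecRect m n = (Finset.range n ×ˢ Finset.range m).image f ∪
      (Finset.range (n + 1) ×ˢ Finset.range (m + 1)).image g := by
    ext ⟨x, y⟩
    simp only [oddAztecRect, Finset.mem_filter, Finset.mem_product, Finset.mem_Icc, Int.even_iff,
      Finset.mem_union, Finset.mem_image, Finset.mem_range, f, g, Prod.exists, Prod.mk.injEq]
    constructor
    · intro h
      rcases Int.emod_two_eq_zero_or_one x with hx | hx
      · exact Or.inr ⟨(x / 2).toNat, (y / 2).toNat, by omega, by omega, by omega⟩
      · exact Or.inl ⟨(x / 2).toNat, (y / 2).toNat, by omega, by omega, by omega⟩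
    · rintro (⟨i, j, h⟩ | ⟨i, j, h⟩) <;> omega
  rw [this, Finset.card_union_of_disjoint, Finset.card_image_of_injective _ hf,
    Finset.card_image_of_injective _ hg]
  · simp only [Finset.card_product, Finset.card_range]
    ring
  · simp only [Finset.disjoint_left, Finset.mem_image, f, g, Prod.exists, not_exists]
    rintro ⟨x, y⟩ ⟨i, j, -, h⟩ i' j' ⟨-, h'⟩
    simp only [Prod.mk.injEq] at h h'
    omega

/-- The windows fit in the frame and their runs are mutually disjoint. -/
structure GoodWindows (m : ℕ) {s : ℕ} (a : Fin s → ℕ) (d : Fin s → ℤ) : Prop where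
  parity : ∀ i, Even (d i - a i)
  left : ∀ i, a i + 2 ≤ d i
  right : ∀ i, d i + a i ≤ 2 * (m + ∑ j, (a j + 1) : ℕ)
  disj : ∀ i j, i ≠ j → d i + a i + 2 ≤ d j - a j ∨ d j + a j + 2 ≤ d i - a i

/-! ### Complementation for Aztec rectangles with windows -/

section Step

variable {m s : ℕ} {a : Fin s → ℕ} {d : Fin s → ℤ}

theorem GoodWindows.inWindow_unique (h : GoodWindows m a d) (k : ℕ) {i j : Fin s}
    {v : ℤ × ℤ} (hi : InWindow m k (a i) (d i) v) (hj : InWindow m k (a j) (d j) v) : i = j := by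
  by_contra hij
  have := h.disj i j hij
  unfold InWindow at hi hj
  omega

theorem GoodWindows.inWindow_inOuter (h : GoodWindows m a d) {k : ℕ} (i : Fin s)
    {v : ℤ × ℤ} (hi : InWindow m k (a i) (d i) v) :
    InOuter m (m + ∑ i, (a i + 1) : ℕ) k v := by
  have h₁ := h.left i
  have h₂ := h.right i
  unfold InWindow at hi
  unfold InOuter
  omega

theorem GoodWindows.windowCell_unique (h : GoodWindows m a d) (k : ℕ) {i j : Fin s}
    {v : ℤ × ℤ} (hi : WindowCell m k (a i) (d i) v) (hj : WindowCell m k (a j) (d j) v) :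
    i = j := by
  by_contra hij
  have := h.disj i j hij
  unfold WindowCell at hi hj
  omega

theorem GoodWindows.windowCell_outerCell (h : GoodWindows m a d) (hm : Even m) {k : ℕ} (i : Fin s)
    {v : ℤ × ℤ} (hi : WindowCell m k (a i) (d i) v) :
    OuterCell m (m + ∑ i, (a i + 1) : ℕ) k v := by
  have h₁ := h.left i
  have h₂ := h.right i
  rw [Nat.even_iff] at hm
  unfold WindowCell at hi
  unfold OuterCell
  omega

theorem GoodWindows.card_add (h : GoodWindows m a d) {k : ℕ} (hm : Even m) (hka : ∀ i, k ≤ a i) :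
    (aztecRectWithWindows m k a d).card + ∑ i, (k * (a i - k) + (k + 1) * (a i - k + 1)) =
      (m + k) * (m + ∑ i, (a i + 1) + k + 1) + (m + k + 1) * (m + ∑ i, (a i + 1) + k) := by
  have hsub : (Finset.univ.biUnion fun i => oddWindow m k (a i - k) (d i)) ⊆
      translateRegion (aztecRect (m + k) (m + k + ∑ i, (a i + 1))) (-k, -k) := by
    rw [Finset.biUnion_subset]
    intro i _ p hp
    rw [add_right_comm m k, mem_translate_aztecRect]
    exact h.inWindow_inOuter i ((mem_oddWindow hm (hka i) (h.parity i)).1 hp)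
  have hcard := Finset.card_sdiff_add_card_eq_card hsub
  rw [Finset.card_biUnion fun i _ j _ hij => by
    rw [Function.onFun, Finset.disjoint_left]
    intro p hp hp'
    exact hij (h.inWindow_unique k ((mem_oddWindow hm (hka i) (h.parity i)).1 hp)
      ((mem_oddWindow hm (hka j) (h.parity j)).1 hp')), card_translateRegion,
      card_aztecRect] at hcard
  simp only [oddWindow, card_translateRegion, card_oddAztecRect] at hcard
  rw [add_right_comm m k] at hcard
  rw [← hcard]
  simp only [aztecRectWithWindows, oddWindow, add_right_comm m k]

open Classical in
theorem GoodWindows.card_filter (h : GoodWindows m a d) {k : ℕ} (hm : Even m)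
    (hka : ∀ i, k + 1 ≤ a i) (v : ℤ × ℤ) :
    ((windowCells m k a d).filter fun c => v ∈ cellSquares c).card =
      (if v ∈ aztecRectWithWindows m (k + 1) a d then 1 else 0) +
        (if v ∈ aztecRectWithWindows m k a d then 1 else 0) := by
  have hka' : ∀ i, k ≤ a i := fun i => (Nat.le_succ k).trans (hka i)
  zify
  rw [card_filter_mem_cellSquares]
  simp only [mem_windowCells, mem_aztecRectWithWindows hm hka h.parity,
    mem_aztecRectWithWindows hm hka' h.parity]
  have hc : ∀ c, (if OuterCell m (m + ∑ i, (a i + 1) : ℕ) k c ∧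
      ∀ i, ¬ WindowCell m k (a i) (d i) c then 1 else 0 : ℤ) = _ := fun c =>
    ite_and_forall_not (fun i hi => h.windowCell_outerCell hm i hi)
      (fun i j => h.windowCell_unique k)
  have hw : ∀ k : ℕ, (if InOuter m (m + ∑ i, (a i + 1) : ℕ) k v ∧
      ∀ i, ¬ InWindow m k (a i) (d i) v then 1 else 0 : ℤ) = _ := fun k =>
    ite_and_forall_not (fun i hi => h.inWindow_inOuter i hi)
      (fun i j => h.inWindow_unique k)
  rw [hc, hc, hc, hc, hw, hw]
  have e₁ := outerCell_count m (m + ∑ i, (a i + 1)) k v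
  have e₂ := Finset.sum_congr rfl fun i (_ : i ∈ Finset.univ) =>
    windowCell_count hm (hka i) (h.parity i) v
  simp only [Finset.sum_add_distrib] at e₂
  linarith

theorem GoodWindows.cell_mem (h : GoodWindows m a d) {k : ℕ} (hm : Even m)
    (hka : ∀ i, k + 1 ≤ a i) {j : ℕ} (hj : j = k ∨ j = k + 1) {x y x' y' : ℤ}
    (hp : (x, y) ∈ aztecRectWithWindows m j a d) (hq : (x', y') ∈ aztecRectWithWindows m j a d)
    (hx : x' = x + 1 ∨ x' = x - 1) (hy : y' = y + 1 ∨ y' = y - 1)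
    (hx2 : (x + k) % 2 = 0) (hy2 : (y' + k) % 2 = 0) : (x, y') ∈ windowCells m k a d := by
  have hja : ∀ i, j ≤ a i := fun i => by have := hka i; omega
  rw [mem_aztecRectWithWindows hm hja h.parity] at hp hq
  rw [mem_windowCells]
  obtain ⟨hp₁, hp₂⟩ := hp
  obtain ⟨hq₁, hq₂⟩ := hq
  rw [Nat.even_iff] at hm
  refine ⟨?_, fun i hi => ?_⟩
  · unfold OuterCell
    unfold InOuter at hp₁ hq₁
    simp only at *
    omega
  · have hp₂ := hp₂ i
    have hq₂ := hq₂ i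
    have hpar := Int.even_iff.1 (h.parity i)
    unfold WindowCell at hi
    unfold InWindow at hp₂ hq₂
    simp only at *
    omega

theorem GoodWindows.numDominoTilings_succ (h : GoodWindows m a d) {k : ℕ} (hm : Even m)
    (hka : ∀ i, k + 1 ≤ a i) :
    numDominoTilings (aztecRectWithWindows m (k + 1) a d) =
      2 ^ ((k + 1) * (s + 1) + m) * numDominoTilings (aztecRectWithWindows m k a d) := by
  have hka' : ∀ i, k ≤ a i := fun i => (Nat.le_succ k).trans (hka i)
  set C := windowCells m k a d with hC
  set G := aztecRectWithWindows m (k + 1) a d with hG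
  set G' := aztecRectWithWindows m k a d with hG'
  have key := numExactCovers_complementation C (fun c hc c' hc' => by
    have h₁ := (mem_windowCells.1 hc).1
    have h₂ := (mem_windowCells.1 hc').1
    unfold OuterCell at h₁ h₂
    rw [Int.even_iff, Int.even_iff]
    omega) G G' (fun v => by
      rw [h.card_filter hm hka v])
  have hodd : ∀ j, (∀ i, j ≤ a i) → ∀ p ∈ aztecRectWithWindows m j a d, Odd (p.1 + p.2) :=
    fun j hj p hp => Int.odd_iff.2 ((mem_aztecRectWithWindows hm hj h.parity).1 hp).1.2
  rw [← numDominoTilings_eq_of_cells k (hodd _ hka) fun x y x' y' hp hq hx hy hx2 hy2 =>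
      h.cell_mem hm hka (Or.inr rfl) hp hq hx hy hx2 hy2,
    ← numDominoTilings_eq_of_cells k (hodd _ hka') fun x y x' y' hp hq hx hy hx2 hy2 =>
      h.cell_mem hm hka (Or.inl rfl) hp hq hx hy hx2 hy2] at key
  -- Double counting of incidences between squares and cells: each cell has four squares, each
  -- square as many cells as there are regions containing it.
  have hdouble : G.card + G'.card = 4 * C.card := by
    have h₁ := Finset.sum_card_bipartiteAbove_eq_sum_card_bipartiteBelow
      (s := C.biUnion cellSquares ∪ (G ∪ G')) (t := C) (fun v c => v ∈ cellSquares c)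
    have h₂ : ∀ c ∈ C, (Finset.bipartiteBelow (fun v c => v ∈ cellSquares c)
        (C.biUnion cellSquares ∪ (G ∪ G')) c).card = 4 := by
      intro c hc
      rw [Finset.bipartiteBelow, Finset.filter_mem_eq_inter, Finset.inter_eq_right.2]
      · simp [cellSquares]
      · exact (Finset.subset_biUnion_of_mem cellSquares hc).trans Finset.subset_union_left
    have h₃ : ∀ v ∈ C.biUnion cellSquares ∪ (G ∪ G'),
        (Finset.bipartiteAbove (fun v c => v ∈ cellSquares c) C v).card =
          (if v ∈ G then 1 else 0) + (if v ∈ G' then 1 else 0) := by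
      intro v _
      rw [Finset.bipartiteAbove]
      convert h.card_filter hm hka v
    rw [Finset.sum_congr rfl h₂, Finset.sum_const, smul_eq_mul,
      Finset.sum_congr rfl h₃,
      Finset.sum_add_distrib,
      ← Finset.card_filter, ← Finset.card_filter, Finset.filter_mem_eq_inter,
      Finset.filter_mem_eq_inter, Finset.inter_eq_right.2, Finset.inter_eq_right.2] at h₁
    · omega
    · exact Finset.subset_union_right.trans Finset.subset_union_right
    · exact Finset.subset_union_left.trans Finset.subset_union_right
  have hcard := h.card_add hm hka
  have hcard' := h.card_add hm hka'
  have hsum : ∑ i, ((k + 1) * (a i - (k + 1)) + (k + 1 + 1) * (a i - (k + 1) + 1)) +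
      s * (4 * k + 4) =
      ∑ i, (k * (a i - k) + (k + 1) * (a i - k + 1)) + 2 * ∑ i, (a i + 1) := by
    have hs : s * (4 * k + 4) = ∑ _i : Fin s, (4 * k + 4) := by simp
    rw [hs, Finset.mul_sum, ← Finset.sum_add_distrib, ← Finset.sum_add_distrib]
    refine Finset.sum_congr rfl fun i _ => ?_
    obtain ⟨b, hb⟩ := Nat.exists_eq_add_of_le (hka i)
    rw [hb, show k + 1 + b - (k + 1) = b by omega, show k + 1 + b - k = b + 1 by omega]
    ring
  -- The outer rectangle gains `4 m + 2 ∑ (aᵢ + 1) + 4 (k + 1)` squares, while by `hsum` the total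
  -- area of the windows changes by `2 ∑ (aᵢ + 1) - 4 s (k + 1)`.
  have hdiff : G.card = G'.card + 4 * ((k + 1) * (s + 1) + m) := by
    rw [← hG] at hcard
    rw [← hG'] at hcard'
    nlinarith
  have hC' : C.card = G'.card / 2 + ((k + 1) * (s + 1) + m) := by omega
  rw [hC', pow_add, mul_comm (2 ^ (G'.card / 2)), mul_right_comm] at key
  exact Nat.eq_of_mul_eq_mul_right (by positivity) key

/-- The exponent is the sum of `j (s + 1) + m` over `j = 1, …, k`. -/
theorem GoodWindows.numDominoTilings_eq (h : GoodWindows m a d) (hm : Even m) (k : ℕ)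
    (hka : ∀ i, k ≤ a i) :
    numDominoTilings (aztecRectWithWindows m k a d) =
      2 ^ ((k + 1).choose 2 * (s + 1) + k * m) *
        numDominoTilings (aztecRectWithWindows m 0 a d) := by
  induction k with
  | zero => simp
  | succ k ih =>
    rw [h.numDominoTilings_succ hm hka, ih fun i => (Nat.le_succ k).trans (hka i), ← mul_assoc,
      ← pow_add, Nat.choose_succ_succ' (k + 1) 1, Nat.choose_one_right]
    congr 2
    ring

end Step

/-! ### Peeling off the bottom row -/

theorem ShareSide.ne {p q : ℤ × ℤ} (h : ShareSide p q) : p ≠ q := by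
  rintro rfl
  simp [ShareSide] at h

open Classical in
theorem numDominoTilings_peel {S : Finset (ℤ × ℤ)} {q : ℤ × ℤ} (hq : q ∈ S) :
    numDominoTilings S = ∑ p ∈ S.filter (ShareSide q), numDominoTilings (S \ {q, p}) := by
  rw [numDominoTilings_eq_numExactCovers, numExactCovers_peel hq (F :=
    (S.filter (ShareSide q)).image fun p => {q, p}) (hE := ?_) ?_, Finset.sum_image]
  · rfl
  · intro p hp p' hp' h
    have hpq := (Finset.mem_filter.1 hp).2.ne
    have : p ∈ ({q, p'} : Finset (ℤ × ℤ)) := by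
      rw [← show ({q, p} : Finset (ℤ × ℤ)) = {q, p'} from h]
      simp
    rw [Finset.mem_insert, Finset.mem_singleton] at this
    exact this.resolve_left hpq.symm
  · rintro δ ⟨p, p', -, rfl⟩
    exact Finset.insert_nonempty _ _
  · intro δ
    simp only [Finset.mem_image, Finset.mem_filter, Set.mem_ofPred_eq]
    constructor
    · rintro ⟨p, ⟨hp, hqp⟩, rfl⟩
      exact ⟨by simp [Finset.insert_subset_iff, hq, hp], ⟨q, p, hqp, rfl⟩, by simp⟩
    · rintro ⟨hδ, ⟨p, p', hpp', rfl⟩, hqδ⟩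
      rw [Finset.mem_insert, Finset.mem_singleton] at hqδ
      rcases hqδ with rfl | rfl
      · exact ⟨p', ⟨hδ (by simp), hpp'⟩, rfl⟩
      · refine ⟨p, ⟨hδ (by simp), ?_⟩, Finset.pair_comm _ _⟩
        simpa only [ShareSide, abs_sub_comm] using hpp'

theorem numDominoTilings_empty : numDominoTilings ∅ = 1 := by
  rw [numDominoTilings_eq_numExactCovers]
  refine numExactCovers_empty ?_
  rintro ⟨p, q, -, h⟩
  exact Finset.insert_ne_empty _ _ h.symm

open Classical in
/-- If every square `q r` has at most two neighbours `nb r false`, `nb r true`, which all lie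
in `U`, the tilings of `U ∪ {q r}` are obtained by choosing the partner of each `q r`. -/
theorem numDominoTilings_union_row : ∀ {j : ℕ} (q : Fin j → ℤ × ℤ) (nb : Fin j → Bool → ℤ × ℤ)
    (U : Finset (ℤ × ℤ)), Function.Injective q → (∀ r, q r ∉ U) →
    (∀ r r', ¬ ShareSide (q r) (q r')) → (∀ r, nb r false ≠ nb r true) →
    (∀ r, ∀ p ∈ U, ShareSide (q r) p ↔ ∃ b, p = nb r b) →
    numDominoTilings (U ∪ Finset.univ.image q) = ∑ ε : Fin j → Bool,
      if Function.Injective (fun r => nb r (ε r)) ∧ ∀ r, nb r (ε r) ∈ U then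
        numDominoTilings (U \ Finset.univ.image fun r => nb r (ε r)) else 0 := by
  intro j
  induction j with
  | zero =>
    intro q nb U _ _ _ _ _
    simp [Function.injective_of_subsingleton]
  | succ j ih =>
    intro q nb U hq hqU hqq hne hnb
    have hq0 : q 0 ∈ U ∪ Finset.univ.image q :=
      Finset.mem_union_right _ (Finset.mem_image_of_mem q (Finset.mem_univ 0))
    have hfilter : (U ∪ Finset.univ.image q).filter (ShareSide (q 0)) =
        (Finset.univ.filter fun b => nb 0 b ∈ U).image (nb 0) := by
      ext p
      simp only [Finset.mem_filter, Finset.mem_union, Finset.mem_image, Finset.mem_univ, true_and]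
      constructor
      · rintro ⟨hp | ⟨r, rfl⟩, hs⟩
        · obtain ⟨b, rfl⟩ := (hnb 0 p hp).1 hs
          exact ⟨b, hp, rfl⟩
        · exact absurd hs (hqq 0 r)
      · rintro ⟨b, hb, rfl⟩
        exact ⟨Or.inl hb, (hnb 0 _ hb).2 ⟨b, rfl⟩⟩
    have hinj : Function.Injective (nb 0) := by
      intro b b' h
      cases b <;> cases b' <;> first | rfl | exact absurd h (hne 0) | exact absurd h.symm (hne 0)
    -- The partner `b` of the first square is chosen; splitting `ε` into its head and its tail
    -- matches the induction.
    rw [numDominoTilings_peel hq0, hfilter, Finset.sum_image fun b _ b' _ h => hinj h,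
      Finset.sum_filter, ← (Fin.consEquiv fun _ => Bool).sum_comp, Fintype.sum_prod_type]
    refine Finset.sum_congr rfl fun b _ => ?_
    split_ifs with hb
    · have hset : (U ∪ Finset.univ.image q) \ {q 0, nb 0 b} =
          (U \ {nb 0 b}) ∪ Finset.univ.image (Fin.tail q) := by
        ext p
        simp only [Finset.mem_sdiff, Finset.mem_union, Finset.mem_image, Finset.mem_univ, true_and,
          Finset.mem_insert, Finset.mem_singleton, Fin.exists_fin_succ, Fin.tail, not_or]
        constructor
        · rintro ⟨hp | rfl | hp, h₁, h₂⟩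
          · exact Or.inl ⟨hp, h₂⟩
          · exact absurd rfl h₁
          · exact Or.inr hp
        · rintro (⟨hp, h⟩ | ⟨r, rfl⟩)
          · exact ⟨Or.inl hp, fun h' => hqU 0 (h' ▸ hp), h⟩
          · exact ⟨Or.inr (Or.inr ⟨r, rfl⟩), fun h => Fin.succ_ne_zero r (hq h),
              fun h => hqU r.succ (h ▸ hb)⟩
      rw [hset, ih (Fin.tail q) (fun r => nb r.succ) (U \ {nb 0 b})
        (hq.comp (Fin.succ_injective _))
        (fun r h => hqU r.succ (Finset.mem_sdiff.1 h).1) (fun r r' => hqq r.succ r'.succ)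
        (fun r => hne r.succ) (fun r p hp => hnb r.succ p (Finset.mem_sdiff.1 hp).1)]
      refine Finset.sum_congr rfl fun ε _ => ?_
      have hcons : (fun r => nb r ((Fin.consEquiv fun _ => Bool) (b, ε) r)) =
          Fin.cons (nb 0 b) fun r => nb r.succ (ε r) := by
        funext r
        refine Fin.cases ?_ (fun r => ?_) r <;> simp [Fin.consEquiv]
      have hall : (∀ r, nb r ((Fin.consEquiv fun _ => Bool) (b, ε) r) ∈ U) ↔
          ∀ r, nb r.succ (ε r) ∈ U := by
        rw [Fin.forall_fin_succ]
        simp [Fin.consEquiv, hb]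
      have hsd : U \ Finset.univ.image (Fin.cons (nb 0 b) fun r => nb r.succ (ε r) :
          Fin (j + 1) → ℤ × ℤ) = (U \ {nb 0 b}) \ Finset.univ.image fun r => nb r.succ (ε r) := by
        ext p
        simp only [Finset.mem_sdiff, Finset.mem_image, Finset.mem_univ, true_and,
          Finset.mem_singleton, Fin.exists_fin_succ, Fin.cons_zero, Fin.cons_succ, not_or,
          and_assoc, eq_comm (a := p)]
      rw [← hsd, ← hcons]
      refine if_congr ?_ rfl rfl
      rw [hall, hcons, Fin.cons_injective_iff]
      simp only [Finset.mem_sdiff, Finset.mem_singleton, Set.mem_range, not_exists]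
      constructor
      · rintro ⟨h₁, h₂⟩
        exact ⟨⟨fun r => (h₂ r).2, h₁⟩, fun r => (h₂ r).1⟩
      · rintro ⟨⟨h₁, h₂⟩, h₃⟩
        exact ⟨h₂, fun r => ⟨h₃ r, h₁ r⟩⟩
    · symm
      refine Finset.sum_eq_zero fun ε _ => if_neg fun h => hb ?_
      simpa [Fin.consEquiv] using h.2 0

/-! ### Rows of the Aztec rectangle -/

/-- The first `y` rows of an Aztec rectangle of width `N`. -/
noncomputable def topRows (N y : ℕ) : Finset (ℤ × ℤ) :=
  (Finset.Icc (0 : ℤ) (2 * N) ×ˢ Finset.Ico (0 : ℤ) y).filter fun p => Odd (p.1 + p.2)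

/-- The squares of the even row `y` with labels in `X`. -/
noncomputable def evenRow (y : ℤ) (X : Finset ℤ) : Finset (ℤ × ℤ) := X.image fun t => (2 * t - 1, y)

/-- The squares of the odd row `y` with labels in `Y`. -/
noncomputable def oddRow (y : ℤ) (Y : Finset ℤ) : Finset (ℤ × ℤ) := Y.image fun t => (2 * t, y)

theorem mem_topRows {N y : ℕ} {p : ℤ × ℤ} : p ∈ topRows N y ↔
    0 ≤ p.1 ∧ p.1 ≤ 2 * N ∧ 0 ≤ p.2 ∧ p.2 < y ∧ (p.1 + p.2) % 2 = 1 := by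
  simp only [topRows, Finset.mem_filter, Finset.mem_product, Finset.mem_Icc, Finset.mem_Ico,
    Int.odd_iff]
  tauto

theorem mem_evenRow {y : ℤ} {X : Finset ℤ} {p : ℤ × ℤ} :
    p ∈ evenRow y X ↔ p.2 = y ∧ p.1 % 2 = 1 ∧ (p.1 + 1) / 2 ∈ X := by
  simp only [evenRow, Finset.mem_image, Prod.ext_iff]
  constructor
  · rintro ⟨t, ht, h₁, h₂⟩
    refine ⟨by omega, by omega, ?_⟩
    rwa [show (p.1 + 1) / 2 = t by omega]
  · rintro ⟨h₁, h₂, h₃⟩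
    exact ⟨_, h₃, by omega, by omega⟩

theorem mem_oddRow {y : ℤ} {Y : Finset ℤ} {p : ℤ × ℤ} :
    p ∈ oddRow y Y ↔ p.2 = y ∧ p.1 % 2 = 0 ∧ p.1 / 2 ∈ Y := by
  simp only [oddRow, Finset.mem_image, Prod.ext_iff]
  constructor
  · rintro ⟨t, ht, h₁, h₂⟩
    refine ⟨by omega, by omega, ?_⟩
    rwa [show p.1 / 2 = t by omega]
  · rintro ⟨h₁, h₂, h₃⟩
    exact ⟨_, h₃, by omega, by omega⟩

theorem shareSide_iff {p q : ℤ × ℤ} : ShareSide p q ↔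
    (q.1 = p.1 + 1 ∨ q.1 = p.1 - 1) ∧ (q.2 = p.2 + 1 ∨ q.2 = p.2 - 1) := by
  unfold ShareSide
  rw [abs_eq zero_le_one, abs_eq zero_le_one]
  omega

/-- The integer `0` or `1` of a choice. -/
def boolInt (b : Bool) : ℤ := if b then 1 else 0

open Classical in
-- Label `y` of an odd row is adjacent to the labels `y` and `y + 1` of the preceding even row. At
-- the two ends one of these falls outside `1, …, N`, whence the range condition.
theorem numDominoTilings_oddRow (N i : ℕ) {j : ℕ} {y : Fin j → ℤ} (hy : StrictMono y)
    (hyN : ∀ r, y r ∈ Finset.Icc (0 : ℤ) N) :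
    numDominoTilings (topRows N (2 * i + 1) ∪ oddRow (2 * i + 1) (Finset.univ.image y)) =
      ∑ ε : Fin j → Bool, if Function.Injective (fun r => y r + boolInt (ε r)) ∧
          ∀ r, y r + boolInt (ε r) ∈ Finset.Icc (1 : ℤ) N then
        numDominoTilings (topRows N (2 * i) ∪
          evenRow (2 * i) (Finset.Icc 1 N \ Finset.univ.image fun r => y r + boolInt (ε r)))
        else 0 := by
  have hrow : oddRow (2 * i + 1) (Finset.univ.image y) =
      Finset.univ.image fun r => ((2 * y r, 2 * i + 1) : ℤ × ℤ) := by
    rw [oddRow, Finset.image_image]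
    rfl
  rw [hrow, numDominoTilings_union_row _
    (fun r b => ((2 * (y r + boolInt b) - 1, 2 * i) : ℤ × ℤ))]
  · refine Finset.sum_congr rfl fun ε _ => if_congr (and_congr ?_ ?_) ?_ rfl
    · simp [Function.Injective]
    · refine forall_congr' fun r => ?_
      rw [mem_topRows, Finset.mem_Icc]
      push_cast
      omega
    · congr 1
      ext ⟨u, v⟩
      simp only [Finset.mem_union, Finset.mem_sdiff, mem_topRows, mem_evenRow, Finset.mem_image,
        Finset.mem_univ, true_and, Finset.mem_Icc, Prod.mk.injEq, not_exists]
      push_cast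
      constructor
      · rintro ⟨h, h'⟩
        by_cases hv : v < 2 * i
        · left; omega
        · right
          refine ⟨by omega, by omega, by omega, fun r hr => h' r (by omega)⟩
      · rintro (h | ⟨h₁, h₂, h₃, h₄⟩)
        · exact ⟨by omega, fun r hr => by omega⟩
        · exact ⟨by omega, fun r hr => h₄ r (by omega)⟩
  · intro r r' h
    simp only [Prod.mk.injEq] at h
    exact hy.injective (by omega)
  · intro r
    rw [mem_topRows]
    push_cast
    omega
  · intro r r'
    rw [shareSide_iff]
    dsimp only
    omega
  · simp [boolInt]
  · intro r p hp
    have := Finset.mem_Icc.1 (hyN r)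
    rw [mem_topRows] at hp
    push_cast at hp
    rw [shareSide_iff, Bool.exists_bool]
    simp only [Prod.ext_iff, boolInt]
    simp
    omega

open Classical in
-- Label `x` of an even row is adjacent to `x - 1` and `x` in the preceding odd row. Both always
-- exist, so only injectivity is required.
theorem numDominoTilings_evenRow (N i : ℕ) {j : ℕ} {x : Fin j → ℤ} (hx : StrictMono x)
    (hxN : ∀ r, x r ∈ Finset.Icc (1 : ℤ) N) :
    numDominoTilings (topRows N (2 * i + 2) ∪ evenRow (2 * i + 2) (Finset.univ.image x)) =
      ∑ ε : Fin j → Bool, if Function.Injective (fun r => x r - 1 + boolInt (ε r)) then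
        numDominoTilings (topRows N (2 * i + 1) ∪
          oddRow (2 * i + 1) (Finset.Icc 0 N \ Finset.univ.image fun r => x r - 1 + boolInt (ε r)))
        else 0 := by
  have hrow : evenRow (2 * i + 2) (Finset.univ.image x) =
      Finset.univ.image fun r => ((2 * x r - 1, 2 * i + 2) : ℤ × ℤ) := by
    rw [evenRow, Finset.image_image]
    rfl
  rw [hrow, numDominoTilings_union_row _
    (fun r b => ((2 * (x r - 1 + boolInt b), 2 * i + 1) : ℤ × ℤ))]
  · refine Finset.sum_congr rfl fun ε _ => if_congr ?_ ?_ rfl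
    · rw [and_iff_left]
      · simp [Function.Injective]
      · intro r
        have := Finset.mem_Icc.1 (hxN r)
        have : boolInt (ε r) = 0 ∨ boolInt (ε r) = 1 := by cases ε r <;> simp [boolInt]
        rw [mem_topRows]
        push_cast
        omega
    · congr 1
      ext ⟨u, v⟩
      simp only [Finset.mem_union, Finset.mem_sdiff, mem_topRows, mem_oddRow, Finset.mem_image,
        Finset.mem_univ, true_and, Finset.mem_Icc, Prod.mk.injEq, not_exists]
      push_cast
      constructor
      · rintro ⟨h, h'⟩
        by_cases hv : v < 2 * i + 1
        · left; omega
        · right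
          refine ⟨by omega, by omega, by omega, fun r hr => h' r (by omega)⟩
      · rintro (h | ⟨h₁, h₂, h₃, h₄⟩)
        · exact ⟨by omega, fun r hr => by omega⟩
        · exact ⟨by omega, fun r hr => h₄ r (by omega)⟩
  · intro r r' h
    simp only [Prod.mk.injEq] at h
    exact hx.injective (by omega)
  · intro r
    rw [mem_topRows]
    push_cast
    omega
  · intro r r'
    rw [shareSide_iff]
    dsimp only
    omega
  · simp [boolInt]
  · intro r p hp
    rw [mem_topRows] at hp
    push_cast at hp
    rw [shareSide_iff, Bool.exists_bool]
    simp only [Prod.ext_iff, boolInt]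
    simp
    omega

/-! ### Vandermonde products of sets of integers -/

/-- The difference `q - p` if it is positive, otherwise `1`. -/
def gap (p q : ℤ) : ℚ := if p < q then q - p else 1

/-- The product of the differences of the elements of `S`. -/
def vandProd (S : Finset ℤ) : ℚ := ∏ p ∈ S, ∏ q ∈ S, gap p q

/-- The product of the distances from `s` to the other elements of `W`. -/
def distProd (W : Finset ℤ) (s : ℤ) : ℚ := ∏ w ∈ W, (gap s w * gap w s)

theorem gap_pos (p q : ℤ) : 0 < gap p q := by
  unfold gap
  split_ifs with h
  · have : (p : ℚ) < q := by exact_mod_cast h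
    linarith
  · exact one_pos

theorem vandProd_pos (S : Finset ℤ) : 0 < vandProd S :=
  Finset.prod_pos fun p _ => Finset.prod_pos fun q _ => gap_pos p q

theorem distProd_pos (W : Finset ℤ) (s : ℤ) : 0 < distProd W s :=
  Finset.prod_pos fun _ _ => mul_pos (gap_pos _ _) (gap_pos _ _)

theorem vandProd_empty : vandProd ∅ = 1 := rfl

theorem vandProd_image {j : ℕ} {x : Fin j → ℤ} (hx : StrictMono x) :
    vandProd (Finset.univ.image x) = (Matrix.vandermonde fun r => (x r : ℚ)).det := by
  rw [vandProd, Matrix.det_vandermonde, Finset.prod_image hx.injective.injOn]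
  refine Finset.prod_congr rfl fun r _ => ?_
  rw [Finset.prod_image hx.injective.injOn]
  simp only [gap, hx.lt_iff_lt]
  rw [← Finset.prod_filter]
  refine Finset.prod_congr ?_ fun _ _ => rfl
  ext
  simp

/-- The Vandermonde products of complementary sets. -/
theorem vandProd_mul_vandProd {S W : Finset ℤ} (h : S ⊆ W) :
    vandProd W * vandProd S = vandProd (W \ S) * ∏ s ∈ S, distProd W s := by
  obtain ⟨C, hC⟩ : ∃ C, C = W \ S := ⟨_, rfl⟩
  have hdisj : Disjoint S C := hC ▸ Finset.disjoint_sdiff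
  have hW : W = S.disjUnion C hdisj := by
    rw [Finset.disjUnion_eq_union, hC, Finset.union_sdiff_of_subset h]
  rw [← hC]
  unfold vandProd distProd
  simp only [hW, Finset.prod_disjUnion, Finset.prod_mul_distrib]
  -- Both sides consist of the blocks `S × S` (twice), `S × C`, `C × S` and `C × C`; only the order
  -- of the products differs.
  rw [Finset.prod_comm (s := S) (t := S) (f := fun s w => gap w s),
    Finset.prod_comm (s := S) (t := C) (f := fun s w => gap w s)]
  ring

/-- Points up to `s` contribute the default value `1` of `gap`, so the lower end is immaterial. -/
theorem prod_gap_right {l s : ℤ} (h : l ≤ s) (b : ℕ) :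
    ∏ w ∈ Finset.Icc l (s + b), gap s w = b.factorial := by
  induction b with
  | zero =>
    rw [Finset.prod_eq_one]
    · simp
    · intro w hw
      rw [Finset.mem_Icc] at hw
      exact if_neg (by push_cast at hw; omega)
  | succ b ih =>
    have : Finset.Icc l (s + (b + 1 : ℕ)) = insert (s + b + 1) (Finset.Icc l (s + b)) := by
      ext
      simp only [Finset.mem_Icc, Finset.mem_insert]
      push_cast
      omega
    rw [this, Finset.prod_insert (by simp), ih, gap, if_pos (by omega), Nat.factorial_succ]
    push_cast
    ring

theorem prod_gap_left {u s : ℤ} (h : s ≤ u) (a : ℕ) :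
    ∏ w ∈ Finset.Icc (s - a) u, gap w s = a.factorial := by
  induction a with
  | zero =>
    rw [Finset.prod_eq_one]
    · simp
    · intro w hw
      rw [Finset.mem_Icc] at hw
      exact if_neg (by push_cast at hw; omega)
  | succ a ih =>
    have : Finset.Icc (s - (a + 1 : ℕ)) u = insert (s - a - 1) (Finset.Icc (s - a) u) := by
      ext
      simp only [Finset.mem_Icc, Finset.mem_insert]
      push_cast
      omega
    rw [this, Finset.prod_insert (by simp), ih, gap, if_pos (by omega), Nat.factorial_succ]
    push_cast
    ring

theorem distProd_Icc (s : ℤ) (a b : ℕ) :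
    distProd (Finset.Icc (s - a) (s + b)) s = a.factorial * b.factorial := by
  rw [distProd, Finset.prod_mul_distrib, prod_gap_right (by omega), prod_gap_left (by omega),
    mul_comm]

/-- The weight with which a choice enters the sum over the partners of an odd row. -/
def choiceWeight (N : ℕ) (y : ℤ) (b : Bool) : ℚ := if b then N - y else y

/-- The distance product of `y` in `0, …, N` is `y! (N - y)!`. In `1, …, N` it is `(y - 1)! (N -
y)!` for `y` and `y! (N - y - 1)!` for `y + 1`; the ratios are `y` and `N - y`. -/
theorem distProd_eq_choiceWeight_mul {N : ℕ} {y : ℤ} {b : Bool}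
    (h : y + boolInt b ∈ Finset.Icc (1 : ℤ) N) (hy : y ∈ Finset.Icc (0 : ℤ) N) :
    distProd (Finset.Icc 0 N) y =
      choiceWeight N y b * distProd (Finset.Icc 1 N) (y + boolInt b) := by
  rw [Finset.mem_Icc] at h hy
  obtain ⟨u, rfl⟩ := Int.eq_ofNat_of_zero_le hy.1
  obtain ⟨v, rfl⟩ := Nat.exists_eq_add_of_le (show u ≤ N by omega)
  have h₀ := distProd_Icc u u v
  rw [show (u : ℤ) - u = 0 by ring] at h₀
  push_cast at h₀ ⊢
  rw [h₀]
  cases b with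
  | true =>
    simp only [boolInt, if_true] at h ⊢
    obtain ⟨v, rfl⟩ := Nat.exists_eq_add_of_le (show 1 ≤ v by omega)
    have h₁ := distProd_Icc (u + 1) u v
    rw [show (u : ℤ) + 1 - u = 1 by ring] at h₁
    rw [show (u : ℤ) + (1 + v : ℕ) = u + 1 + v by push_cast; ring, h₁, choiceWeight, if_pos rfl,
      add_comm 1 v, Nat.factorial_succ]
    push_cast
    ring
  | false =>
    simp only [boolInt, Bool.false_eq_true, if_false, add_zero] at h ⊢
    obtain ⟨u, rfl⟩ := Nat.exists_eq_add_of_le (show 1 ≤ u by omega)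
    have h₁ := distProd_Icc ((1 + u : ℕ) : ℤ) u v
    rw [show ((1 + u : ℕ) : ℤ) - u = 1 by push_cast; ring] at h₁
    rw [h₁, choiceWeight, if_neg (by simp), add_comm 1 u, Nat.factorial_succ]
    push_cast
    ring

/-- The weights kill the choices that leave the row, so the range condition disappears from the
weighted sum. -/
theorem choiceWeight_eq_zero {N : ℕ} {y : ℤ} {b : Bool}
    (h : y + boolInt b ∉ Finset.Icc (1 : ℤ) N) (hy : y ∈ Finset.Icc (0 : ℤ) N) :
    choiceWeight N y b = 0 := by
  rw [Finset.mem_Icc] at h hy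
  cases b with
  | true =>
    simp only [boolInt, if_true] at h
    have : y = N := by omega
    simp [choiceWeight, this]
  | false =>
    simp only [boolInt, Bool.false_eq_true, if_false] at h
    have : y = 0 := by omega
    simp [choiceWeight, this]

theorem vandProd_Icc_zero (N : ℕ) :
    vandProd (Finset.Icc 0 N) = N.factorial * vandProd (Finset.Icc (1 : ℤ) N) := by
  have h := vandProd_mul_vandProd (S := {0}) (W := Finset.Icc (0 : ℤ) N) (by simp)
  have h₁ : vandProd {0} = 1 := by simp [vandProd, gap]
  have h₂ := distProd_Icc 0 0 N
  have h₃ : Finset.Icc (0 : ℤ) N \ {0} = Finset.Icc (1 : ℤ) N := by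
    ext
    simp only [Finset.mem_sdiff, Finset.mem_Icc, Finset.mem_singleton]
    omega
  simp only [Nat.cast_zero, sub_zero, zero_add, Nat.factorial_zero, Nat.cast_one, one_mul] at h₂
  rw [h₁, h₃, Finset.prod_singleton, h₂, mul_one] at h
  rw [h, mul_comm]

/-! ### Determinants -/

theorem det_sum_rows {R : Type*} [CommRing R] {j : ℕ} {β : Type*} [Fintype β]
    (g : Fin j → β → Fin j → R) :
    (Matrix.of fun r c => ∑ b, g r b c).det =
      ∑ ε : Fin j → β, (Matrix.of fun r c => g r (ε r) c).det := by
  have := (Matrix.detRowAlternating (n := Fin j) (R := R)).toMultilinearMap.map_sum g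
  have e : (Matrix.of fun r c => ∑ b, g r b c) = Matrix.of fun r => ∑ b, g r b := by
    ext r c
    simp
  rw [e]
  exact this

theorem det_monic {j : ℕ} (v : Fin j → ℚ) (P : ℕ → Polynomial ℚ)
    (hP : ∀ c, (P c).Monic ∧ (P c).natDegree = c) :
    (Matrix.of fun r (c : Fin j) => (P c).eval (v r)).det = (Matrix.vandermonde v).det :=
  (Matrix.det_eval_matrixOfPolynomials_eq_det_vandermonde v (fun c => P c)
    (fun c => (hP c).2) fun c => (hP c).1).symm

theorem det_prod_sub {j : ℕ} (v : Fin j → ℚ) (z : ℕ → ℚ) :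
    (Matrix.of fun r (c : Fin j) => ∏ l ∈ Finset.range c, (v r - z l)).det =
      (Matrix.vandermonde v).det := by
  rw [← det_monic v fun c => ∏ l ∈ Finset.range c, (Polynomial.X - Polynomial.C (z l))]
  · simp [Polynomial.eval_prod]
  · intro c
    exact ⟨Polynomial.monic_prod_of_monic _ _ fun l _ => Polynomial.monic_X_sub_C _, by simp⟩

theorem det_vandermonde_of_not_injective {j : ℕ} {p : Fin j → ℤ} (h : ¬ Function.Injective p) :
    (Matrix.vandermonde fun r => (p r : ℚ)).det = 0 := by
  rw [Matrix.det_vandermonde_eq_zero_iff]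
  simp only [Function.Injective, not_forall] at h
  obtain ⟨r, r', h, hne⟩ := h
  exact ⟨r, r', by rw [h], hne⟩

/-- Consecutive integers of a strictly increasing sequence are at least one apart, so shifts by `0`
or `1` can produce ties but no inversions. -/
theorem strictMono_add_boolInt {j : ℕ} {y : Fin j → ℤ} (hy : StrictMono y) {ε : Fin j → Bool}
    (h : Function.Injective fun r => y r + boolInt (ε r)) :
    StrictMono fun r => y r + boolInt (ε r) := by
  refine Monotone.strictMono_of_injective (fun r r' hr => ?_) h
  rcases hr.eq_or_lt with rfl | hr
  · exact le_rfl
  · have := hy hr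
    have h0 : ∀ b, boolInt b = 0 ∨ boolInt b = 1 := fun b => by cases b <;> simp [boolInt]
    have := h0 (ε r)
    have := h0 (ε r')
    omega

open Classical in
-- Noninjective choices give a vanishing Vandermonde determinant and may be included. By
-- multilinearity in the rows the sum is then the determinant with entries `(x + 1) ^ c + x ^ c`,
-- and these are twice monic polynomials of degree `c`.
theorem sum_vandProd_choices {j : ℕ} {x : Fin j → ℤ} (hx : StrictMono x) :
    (∑ ε : Fin j → Bool, if Function.Injective (fun r => x r + boolInt (ε r)) then
      vandProd (Finset.univ.image fun r => x r + boolInt (ε r)) else 0) =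
      2 ^ j * vandProd (Finset.univ.image x) := by
  have h₁ : ∀ ε : Fin j → Bool, (if Function.Injective (fun r => x r + boolInt (ε r)) then
      vandProd (Finset.univ.image fun r => x r + boolInt (ε r)) else 0) =
      (Matrix.of fun r (c : Fin j) => ((x r : ℚ) + boolInt (ε r)) ^ (c : ℕ)).det := by
    intro ε
    have : (Matrix.of fun r (c : Fin j) => ((x r : ℚ) + boolInt (ε r)) ^ (c : ℕ)) =
        Matrix.vandermonde fun r => ((x r + boolInt (ε r) : ℤ) : ℚ) := by
      ext r c
      simp [Matrix.vandermonde_apply]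
    rw [this]
    split_ifs with h
    · exact vandProd_image (strictMono_add_boolInt hx h)
    · exact (det_vandermonde_of_not_injective h).symm
  rw [Finset.sum_congr rfl fun ε _ => h₁ ε,
    ← det_sum_rows fun r b (c : Fin j) => ((x r : ℚ) + boolInt b) ^ (c : ℕ), vandProd_image hx]
  let P : ℕ → Polynomial ℚ := fun c =>
    Polynomial.C (1 / 2) * ((Polynomial.X + Polynomial.C 1) ^ c + Polynomial.X ^ c)
  have hP : ∀ c, (P c).Monic ∧ (P c).natDegree = c := by
    intro c
    have hdeg : (P c).natDegree ≤ c := by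
      refine (Polynomial.natDegree_C_mul_le _ _).trans ?_
      refine Polynomial.natDegree_add_le_of_degree_le ?_ ?_
      · rw [Polynomial.natDegree_pow_X_add_C]
      · exact Polynomial.natDegree_X_pow_le c
    have hcoeff : (P c).coeff c = 1 := by
      have h := (Polynomial.monic_X_add_C (1 : ℚ)).pow c
      rw [Polynomial.Monic, Polynomial.leadingCoeff, Polynomial.natDegree_pow_X_add_C] at h
      rw [Polynomial.coeff_C_mul, Polynomial.coeff_add, h, Polynomial.coeff_X_pow_self]
      norm_num
    have hm := Polynomial.monic_of_natDegree_le_of_coeff_eq_one c hdeg hcoeff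
    refine ⟨hm, le_antisymm hdeg (Polynomial.le_natDegree_of_ne_zero ?_)⟩
    rw [hcoeff]
    exact one_ne_zero
  rw [← det_monic _ P hP]
  have : (Matrix.of fun r (c : Fin j) => ∑ b : Bool, ((x r : ℚ) + boolInt b) ^ (c : ℕ)) =
      Matrix.of fun r (c : Fin j) => (fun _ => (2 : ℚ)) r *
        (Matrix.of fun r (c : Fin j) => (P c).eval (x r : ℚ)) r c := by
    ext r c
    simp [P, boolInt]
  rw [this, Matrix.det_mul_column]
  simp

open Classical in
-- The complementary-set formula replaces each complement by the chosen set, at the cost of distance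
-- products whose dependence on `ε` is a product of choice weights. The sum thus becomes one
-- determinant, whose columns, in a basis of falling factorials, are multiples of falling factorials
-- again.
theorem sum_vandProd_compl_choices {i j N : ℕ} (hN : j + i = N) {y : Fin j → ℤ} (hy : StrictMono y)
    (hyN : ∀ r, y r ∈ Finset.Icc (0 : ℤ) N) :
    (∑ ε : Fin j → Bool, if Function.Injective (fun r => y r + boolInt (ε r)) ∧
        ∀ r, y r + boolInt (ε r) ∈ Finset.Icc (1 : ℤ) N then
      vandProd (Finset.Icc 1 N \ Finset.univ.image fun r => y r + boolInt (ε r)) else 0) =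
      vandProd (Finset.Icc 0 N \ Finset.univ.image y) / i.factorial := by
  have hpos : ∀ r, distProd (Finset.Icc 0 N) (y r) ≠ 0 := fun r => (distProd_pos _ _).ne'
  have hvpos : vandProd (Finset.Icc 1 N) ≠ 0 := (vandProd_pos _).ne'
  have hDpos : ∏ r, distProd (Finset.Icc 0 N) (y r) ≠ 0 :=
    Finset.prod_ne_zero_iff.2 fun r _ => hpos r
  have h₁ : ∀ ε : Fin j → Bool, (if Function.Injective (fun r => y r + boolInt (ε r)) ∧
        ∀ r, y r + boolInt (ε r) ∈ Finset.Icc (1 : ℤ) N then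
      vandProd (Finset.Icc 1 N \ Finset.univ.image fun r => y r + boolInt (ε r)) else 0) =
      vandProd (Finset.Icc 1 N) / (∏ r, distProd (Finset.Icc 0 N) (y r)) *
        (Matrix.of fun r (c : Fin j) => choiceWeight N (y r) (ε r) *
          ∏ l ∈ Finset.range c, ((y r : ℚ) + boolInt (ε r) - (l + 1))).det := by
    intro ε
    have hdet : (Matrix.of fun r (c : Fin j) => choiceWeight N (y r) (ε r) *
          ∏ l ∈ Finset.range c, ((y r : ℚ) + boolInt (ε r) - (l + 1))).det =
        (∏ r, choiceWeight N (y r) (ε r)) *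
          (Matrix.vandermonde fun r => ((y r + boolInt (ε r) : ℤ) : ℚ)).det := by
      rw [← det_prod_sub _ fun l => (l : ℚ) + 1, ← Matrix.det_mul_column]
      push_cast
      rfl
    rw [hdet]
    split_ifs with h
    · obtain ⟨hinj, hmem⟩ := h
      have hsub : (Finset.univ.image fun r => y r + boolInt (ε r)) ⊆ Finset.Icc (1 : ℤ) N := by
        intro t ht
        obtain ⟨r, -, rfl⟩ := Finset.mem_image.1 ht
        exact hmem r
      have hv := vandProd_mul_vandProd hsub
      rw [Finset.prod_image hinj.injOn] at hv
      rw [← vandProd_image (strictMono_add_boolInt hy hinj)]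
      have hprod : ∏ r, distProd (Finset.Icc 0 N) (y r) = (∏ r, choiceWeight N (y r) (ε r)) *
          ∏ r, distProd (Finset.Icc 1 N) (y r + boolInt (ε r)) := by
        rw [← Finset.prod_mul_distrib]
        exact Finset.prod_congr rfl fun r _ => distProd_eq_choiceWeight_mul (hmem r) (hyN r)
      rw [eq_comm, div_mul_eq_mul_div, div_eq_iff hDpos, hprod]
      linear_combination (∏ r, choiceWeight N (y r) (ε r)) * hv
    · rw [not_and_or] at h
      rcases h with h | h
      · rw [det_vandermonde_of_not_injective h]
        simp
      · push Not at h
        obtain ⟨r, hr⟩ := h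
        have hz : ∏ r, choiceWeight N (y r) (ε r) = 0 :=
          Finset.prod_eq_zero (Finset.mem_univ r) (choiceWeight_eq_zero hr (hyN r))
        rw [hz, zero_mul, mul_zero]
  rw [Finset.sum_congr rfl fun ε _ => h₁ ε, ← Finset.mul_sum,
    ← det_sum_rows fun r b (c : Fin j) => choiceWeight N (y r) b *
          ∏ l ∈ Finset.range c, ((y r : ℚ) + boolInt b - (l + 1))]
  have hmat : (Matrix.of fun r (c : Fin j) => ∑ b, choiceWeight N (y r) b *
          ∏ l ∈ Finset.range c, ((y r : ℚ) + boolInt b - (l + 1))) =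
      Matrix.of fun r (c : Fin j) => (fun c : Fin j => (N : ℚ) - c) c *
        (Matrix.of fun r (c : Fin j) => ∏ l ∈ Finset.range c, ((y r : ℚ) - l)) r c := by
    ext r c
    simp only [Matrix.of_apply, Fintype.sum_bool, choiceWeight, boolInt, if_true,
      Bool.false_eq_true, if_false]
    push_cast
    -- Both sides are `z (z - 1) ⋯ (z - c)`. Hence the choices `y` and `y + 1` contribute `y - c`
    -- and `N - y` times the same falling factorial, and `N - c` in total.
    have e : ∀ z : ℚ, z * ∏ l ∈ Finset.range c, (z + 0 - (l + 1)) =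
        (z - c) * ∏ l ∈ Finset.range c, (z - l) := by
      intro z
      generalize (c : ℕ) = c
      induction c with
      | zero => simp
      | succ c ih =>
        rw [Finset.prod_range_succ, Finset.prod_range_succ, ← mul_assoc, ih]
        push_cast
        ring
    rw [e]
    simp only [add_sub_add_right_eq_sub]
    ring
  rw [hmat, Matrix.det_mul_row, det_prod_sub, ← vandProd_image hy]
  have hsub : Finset.univ.image y ⊆ Finset.Icc (0 : ℤ) N := by
    intro t ht
    obtain ⟨r, -, rfl⟩ := Finset.mem_image.1 ht
    exact hyN r
  have hv := vandProd_mul_vandProd hsub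
  rw [Finset.prod_image hy.injective.injOn, vandProd_Icc_zero] at hv
  have hfac : (i.factorial : ℚ) * ∏ c : Fin j, ((N : ℚ) - c) = N.factorial := by
    rw [Fin.prod_univ_eq_prod_range (fun c => (N : ℚ) - c) j, ← hN]
    clear * -
    induction j with
    | zero => simp
    | succ j ih =>
      rw [Finset.prod_range_succ', show j + 1 + i = (j + i) + 1 by ring, Nat.factorial_succ]
      push_cast
      rw [← ih]
      push_cast
      simp only [show ∀ k : ℚ, (j : ℚ) + i + 1 - (k + 1) = j + i - k by intro k; ring]
      ring
  have hi : (i.factorial : ℚ) ≠ 0 := by positivity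
  rw [eq_div_iff hi, div_mul_eq_mul_div, div_mul_eq_mul_div, div_eq_iff hDpos, ← hv, ← hfac]
  ring

/-! ### Tilings of half of an Aztec rectangle -/

/-- The number of tilings of a half Aztec rectangle, divided by the Vandermonde product. -/
def halfConst (i : ℕ) : ℚ := 2 ^ (i * (i + 1) / 2) / ∏ j ∈ Finset.range i, (j.factorial : ℚ)

theorem halfConst_succ (i : ℕ) : halfConst (i + 1) = 2 ^ (i + 1) * (halfConst i / i.factorial) := by
  have : (i + 1) * (i + 1 + 1) / 2 = i * (i + 1) / 2 + (i + 1) := by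
    rw [show (i + 1) * (i + 1 + 1) = i * (i + 1) + 2 * (i + 1) by ring,
      Nat.add_mul_div_left _ _ two_pos]
  rw [halfConst, halfConst, this, Finset.prod_range_succ, pow_add]
  have h : ∏ j ∈ Finset.range i, (j.factorial : ℚ) ≠ 0 := by positivity
  have h' : (i.factorial : ℚ) ≠ 0 := by positivity
  field_simp

theorem topRows_zero (N : ℕ) : topRows N 0 = ∅ := by
  ext p
  rw [mem_topRows]
  simp
  omega

theorem exists_strictMono_eq_image {S : Finset ℤ} {j : ℕ} (h : S.card = j) :
    ∃ x : Fin j → ℤ, StrictMono x ∧ Finset.univ.image x = S ∧ ∀ r, x r ∈ S :=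
  ⟨S.orderEmbOfFin h, (S.orderEmbOfFin h).strictMono, by
    ext t
    rw [Finset.mem_image]
    simp only [Finset.mem_univ, true_and]
    have := Finset.range_orderEmbOfFin S h
    rw [← Finset.mem_coe, ← this, Set.mem_range], fun r => Finset.orderEmbOfFin_mem S h r⟩

theorem card_Icc_sdiff_image {N j : ℕ} {l : ℤ} {p : Fin j → ℤ} (hp : Function.Injective p)
    (h : ∀ r, p r ∈ Finset.Icc l N) :
    (Finset.Icc l N \ Finset.univ.image p).card + j = (N + 1 - l).toNat := by
  have hsub : Finset.univ.image p ⊆ Finset.Icc l N := by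
    intro t ht
    obtain ⟨r, -, rfl⟩ := Finset.mem_image.1 ht
    exact h r
  have := Finset.card_sdiff_add_card_eq_card hsub
  rwa [Finset.card_image_of_injective _ hp, Finset.card_fin, Int.card_Icc] at this

/-- The number of tilings of the upper half of an Aztec rectangle together with some squares of
the axis. -/
theorem numDominoTilings_half (N i : ℕ) : ∀ X ⊆ Finset.Icc (1 : ℤ) N, X.card = i →
    (numDominoTilings (topRows N (2 * i) ∪ evenRow (2 * i) X) : ℚ) = halfConst i * vandProd X := by
  classical
  induction i with
  | zero =>
    intro X _ hX
    rw [Finset.card_eq_zero] at hX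
    subst hX
    simp [topRows_zero, evenRow, numDominoTilings_empty, halfConst, vandProd_empty]
  | succ i ih =>
    -- The intermediate count ends in an odd row; it is expressed through the `i + 1` labels missing
    -- from that row.
    have hodd : ∀ Y ⊆ Finset.Icc (0 : ℤ) N, Y.card + i = N →
        (numDominoTilings (topRows N (2 * i + 1) ∪ oddRow (2 * i + 1) Y) : ℚ) =
          halfConst i / i.factorial * vandProd (Finset.Icc 0 N \ Y) := by
      intro Y hY hcard
      obtain ⟨y, hy, hyY, hmem⟩ := exists_strictMono_eq_image (rfl : Y.card = Y.card)
      have hyN : ∀ r, y r ∈ Finset.Icc (0 : ℤ) N := fun r => hY (hmem r)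
      rw [← hyY, numDominoTilings_oddRow N i hy hyN, div_mul_eq_mul_div, mul_div_assoc,
        ← sum_vandProd_compl_choices hcard hy hyN, Finset.mul_sum, Nat.cast_sum]
      refine Finset.sum_congr rfl fun ε _ => ?_
      split_ifs with h
      · refine ih _ Finset.sdiff_subset ?_
        have := card_Icc_sdiff_image h.1 h.2
        omega
      · simp
    intro X hX hcard
    obtain ⟨x, hx, hxX, hmem⟩ := exists_strictMono_eq_image hcard
    have hxN : ∀ r, x r ∈ Finset.Icc (1 : ℤ) N := fun r => hX (hmem r)
    have hx' : StrictMono fun r => x r - 1 := fun r r' h => sub_lt_sub_right (hx h) 1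
    -- The choices start from `x r - 1`; translation does not change differences.
    have hshift : vandProd (Finset.univ.image x) =
        vandProd (Finset.univ.image fun r => x r - 1) := by
      rw [vandProd_image hx, vandProd_image hx']
      push_cast
      exact (Matrix.det_vandermonde_sub (fun r => (x r : ℚ)) 1).symm
    rw [← hxX, show (2 * ((i + 1 : ℕ) : ℤ)) = 2 * i + 2 by push_cast; ring,
      show 2 * (i + 1) = 2 * i + 2 by ring,
      numDominoTilings_evenRow N i hx hxN, halfConst_succ, hshift, mul_assoc, mul_left_comm,
      ← sum_vandProd_choices hx', Finset.mul_sum, Nat.cast_sum]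
    refine Finset.sum_congr rfl fun ε _ => ?_
    split_ifs with h
    · have hp : ∀ r, x r - 1 + boolInt (ε r) ∈ Finset.Icc (0 : ℤ) N := by
        intro r
        have h0 : ∀ b, boolInt b = 0 ∨ boolInt b = 1 := fun b => by cases b <;> simp [boolInt]
        have := h0 (ε r)
        have := hxN r
        rw [Finset.mem_Icc] at this ⊢
        omega
      -- The labels missing from the odd row are exactly the partners of the even row.
      rw [hodd _ Finset.sdiff_subset, Finset.sdiff_sdiff_eq_self]
      · intro t ht
        obtain ⟨r, -, rfl⟩ := Finset.mem_image.1 ht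
        exact hp r
      · have := card_Icc_sdiff_image h hp
        omega
    · simp

/-- The number of squares in even rows minus the number of squares in odd rows. -/
def rowBalance (S : Finset (ℤ × ℤ)) : ℤ := ∑ p ∈ S, if p.2 % 2 = 0 then 1 else -1

/-- Every domino has one square in an even row and one in an odd row. -/
theorem rowBalance_eq_zero {S : Finset (ℤ × ℤ)} (h : numDominoTilings S ≠ 0) :
    rowBalance S = 0 := by
  classical
  induction S using Finset.strongInduction with
  | H S ih =>
    rcases S.eq_empty_or_nonempty with rfl | ⟨q, hq⟩
    · rfl
    · rw [numDominoTilings_peel hq] at h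
      obtain ⟨p, hp, hne⟩ := Finset.exists_ne_zero_of_sum_ne_zero h
      rw [Finset.mem_filter] at hp
      have hsub : {q, p} ⊆ S := by simp [Finset.insert_subset_iff, hq, hp.1]
      have h0 := ih (S \ {q, p}) (Finset.sdiff_ssubset hsub (Finset.insert_nonempty _ _)) hne
      rw [rowBalance, ← Finset.sum_sdiff hsub, ← rowBalance, h0, Finset.sum_pair hp.2.ne]
      have := shareSide_iff.1 hp.2
      split_ifs <;> omega

theorem rowBalance_union {S T : Finset (ℤ × ℤ)} (h : Disjoint S T) :
    rowBalance (S ∪ T) = rowBalance S + rowBalance T := Finset.sum_union h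

theorem rowBalance_evenRow (i : ℤ) (X : Finset ℤ) : rowBalance (evenRow (2 * i) X) = X.card := by
  rw [rowBalance, evenRow, Finset.sum_image fun t _ t' _ h => by
    simp only [Prod.mk.injEq] at h
    omega]
  simp

theorem rowBalance_oddRow (i : ℤ) (Y : Finset ℤ) :
    rowBalance (oddRow (2 * i + 1) Y) = -Y.card := by
  rw [rowBalance, oddRow, Finset.sum_image fun t _ t' _ h => by
    simp only [Prod.mk.injEq] at h
    omega]
  simp [Int.add_emod]

/-- An even row has `N` squares and an odd row `N + 1`. -/
theorem rowBalance_topRows (N i : ℕ) : rowBalance (topRows N (2 * i)) = -i := by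
  induction i with
  | zero => simp [topRows_zero, rowBalance]
  | succ i ih =>
    have : topRows N (2 * (i + 1)) = topRows N (2 * i) ∪
        (evenRow (2 * i) (Finset.Icc 1 N) ∪ oddRow (2 * i + 1) (Finset.Icc 0 N)) := by
      ext p
      simp only [Finset.mem_union, mem_topRows, mem_evenRow, mem_oddRow, Finset.mem_Icc]
      push_cast
      omega
    rw [this, rowBalance_union, rowBalance_union, ih, rowBalance_evenRow, rowBalance_oddRow]
    · simp
      ring
    · rw [Finset.disjoint_left]
      intro p
      rw [mem_evenRow, mem_oddRow]
      omega
    · rw [Finset.disjoint_left]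
      intro p
      rw [Finset.mem_union, mem_evenRow, mem_oddRow, mem_topRows]
      push_cast
      omega

theorem disjoint_topRows_evenRow (N i : ℕ) (X : Finset ℤ) :
    Disjoint (topRows N (2 * i)) (evenRow (2 * i) X) := by
  rw [Finset.disjoint_left]
  intro p
  rw [mem_evenRow, mem_topRows]
  push_cast
  omega

theorem numDominoTilings_half_eq_zero (N i : ℕ) {X : Finset ℤ} (hX : X.card ≠ i) :
    numDominoTilings (topRows N (2 * i) ∪ evenRow (2 * i) X) = 0 := by
  by_contra h
  have := rowBalance_eq_zero h
  rw [rowBalance_union (disjoint_topRows_evenRow N i X), rowBalance_topRows,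
    rowBalance_evenRow] at this
  omega

/-! ### Sums of products of complementary Vandermonde products -/

/-- The easy half of the Frobenius–König theorem: by pigeonhole every permutation meets the zero
block. -/
theorem det_eq_zero_of_zero_block {ι R : Type*} [Fintype ι] [DecidableEq ι] [CommRing R]
    (M : Matrix ι ι R) (S C : Finset ι) (h : ∀ r ∈ S, ∀ c ∈ C, M r c = 0)
    (hcard : Fintype.card ι < S.card + C.card) : M.det = 0 := by
  rw [Matrix.det_apply']
  refine Finset.sum_eq_zero fun σ _ => ?_
  obtain ⟨r, hr⟩ : (S ∩ C.map σ.toEmbedding).Nonempty := by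
    rw [← Finset.card_pos]
    have h₁ := Finset.card_union_add_card_inter S (C.map σ.toEmbedding)
    have h₂ := Finset.card_le_univ (S ∪ C.map σ.toEmbedding)
    rw [Finset.card_map] at h₁
    omega
  rw [Finset.mem_inter, Finset.mem_map] at hr
  obtain ⟨hrS, c, hc, rfl⟩ := hr
  have hz : ∏ i, M (σ i) i = 0 := Finset.prod_eq_zero (Finset.mem_univ c) (h _ hrS c hc)
  rw [hz, mul_zero]

/-! ### The sign of a shuffle -/

section Shuffle

variable {n : ℕ} {S : Finset (Fin (n + n))} (hS : S.card = n) (hSc : Sᶜ.card = n)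

/-- The permutation that lists first the elements of `S`, then the elements of its complement. -/
def shufflePerm : Equiv.Perm (Fin (n + n)) :=
  finSumFinEquiv.symm.trans (finSumEquivOfFinset hS hSc)

theorem shufflePerm_castAdd (a : Fin n) :
    shufflePerm hS hSc (Fin.castAdd n a) = S.orderEmbOfFin hS a := by
  simp [shufflePerm]

theorem shufflePerm_natAdd (b : Fin n) :
    shufflePerm hS hSc (Fin.natAdd n b) = Sᶜ.orderEmbOfFin hSc b := by
  simp [shufflePerm, -Fin.natAdd_eq_addNat]

theorem sign_shufflePerm : Equiv.Perm.sign (shufflePerm hS hSc) =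
    ∏ b, ∏ a, if S.orderEmbOfFin hS a < Sᶜ.orderEmbOfFin hSc b then 1 else -1 := by
  have hIoi : ∀ i : Fin (n + n), Finset.Ioi i = Finset.univ.filter (i < ·) := fun i => by
    ext
    simp
  have h₁ : ∀ a b : Fin n, ¬ Fin.natAdd n a < Fin.castAdd n b := fun a b => by
    rw [Fin.lt_def, Fin.val_natAdd, Fin.val_castAdd]
    omega
  have h₂ : ∀ a b : Fin n, Fin.castAdd n a < Fin.natAdd n b := fun a b => by
    rw [Fin.lt_def, Fin.val_natAdd, Fin.val_castAdd]
    omega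
  have h₃ : ∀ a b : Fin n, Fin.castAdd n a < Fin.castAdd n b ↔ a < b := fun a b => by
    rw [Fin.lt_def, Fin.lt_def, Fin.val_castAdd, Fin.val_castAdd]
  have h₄ : ∀ a b : Fin n, Fin.natAdd n a < Fin.natAdd n b ↔ a < b := fun a b => by
    rw [Fin.lt_def, Fin.lt_def, Fin.val_natAdd, Fin.val_natAdd]
    omega
  have h₅ : ∀ (p : Prop) [Decidable p], (if p then if p then (1 : ℤˣ) else -1 else 1) = 1 :=
    fun p _ => by split_ifs <;> rfl
  rw [Equiv.Perm.sign_eq_prod_prod_Ioi, Finset.prod_comm (s := (Finset.univ : Finset (Fin n)))]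
  simp only [hIoi, Finset.prod_filter]
  simp only [Fin.prod_univ_add, shufflePerm_castAdd, shufflePerm_natAdd, h₁, h₂, h₃, h₄, if_true,
    if_false, OrderEmbedding.lt_iff_lt, h₅, Finset.prod_const_one, one_mul, mul_one]

/-- The `b`-th element `t` of the complement exceeds `t - b` elements of `S`, so it is inverted with
`n + b - t` of them. Multiplying by `(-1) ^ t` leaves a sign independent of `S`. -/
theorem sign_shufflePerm_mul : ((Equiv.Perm.sign (shufflePerm hS hSc) : ℤ) : ℚ) *
    ∏ b, (-1 : ℚ) ^ (Sᶜ.orderEmbOfFin hSc b : ℕ) = ∏ b : Fin n, (-1 : ℚ) ^ (n + b : ℕ) := by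
  rw [sign_shufflePerm]
  push_cast
  rw [← Finset.prod_mul_distrib]
  refine Finset.prod_congr rfl fun b _ => ?_
  set t := Sᶜ.orderEmbOfFin hSc b with ht
  set A := Finset.univ.filter fun a => S.orderEmbOfFin hS a < t with hA
  have hsplit : (∏ a, (((if S.orderEmbOfFin hS a < t then (1 : ℤˣ) else -1 : ℤˣ) : ℤ) : ℚ)) =
      (-1) ^ Aᶜ.card := by
    have : ∀ a, (((if S.orderEmbOfFin hS a < t then (1 : ℤˣ) else -1 : ℤˣ) : ℤ) : ℚ) =
        if S.orderEmbOfFin hS a < t then 1 else -1 := fun a => by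
      split_ifs <;> simp
    rw [Finset.prod_congr rfl fun a _ => this a, Finset.prod_ite, Finset.prod_const_one, one_mul,
      Finset.prod_const, hA, Finset.compl_filter]
  have hcount : (t : ℕ) = A.card + b := by
    have h₁ : (t : ℕ) = ∑ r, if r < t then 1 else 0 := by
      rw [← Finset.card_filter, ← Fin.card_Iio]
      congr 1
      ext
      simp
    rw [h₁, ← Equiv.sum_comp (shufflePerm hS hSc), Fin.sum_univ_add]
    simp only [shufflePerm_castAdd, shufflePerm_natAdd]
    congr 1
    · rw [hA, Finset.card_filter]
    · simp only [ht, OrderEmbedding.lt_iff_lt]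
      rw [← Finset.card_filter]
      conv_rhs => rw [← Fin.card_Iio b]
      congr 1
      ext
      simp
  have hc := Finset.card_compl_add_card A
  rw [Fintype.card_fin] at hc
  rw [hsplit, hcount, ← pow_add, ← add_assoc, hc]

end Shuffle

/-! ### Block rows and the Laplace expansion -/

section Rows

variable {n : ℕ} (x : Fin (n + n) → ℚ)

/-- The rows of the matrix `(V | 0)`, where `V` has the entries `x r ^ c`. -/
def leftRow (r : Fin (n + n)) : Fin (n + n) → ℚ := Fin.append (fun c : Fin n => x r ^ (c : ℕ)) 0

/-- The rows of the matrix `(0 | V')`, where `V'` has the entries `(-1) ^ r * x r ^ c`. -/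
def rightRow (r : Fin (n + n)) : Fin (n + n) → ℚ :=
  Fin.append 0 fun c : Fin n => (-1) ^ (r : ℕ) * x r ^ (c : ℕ)

theorem leftRow_castAdd (r : Fin (n + n)) (c : Fin n) :
    leftRow x r (Fin.castAdd n c) = x r ^ (c : ℕ) := Fin.append_left _ _ _

theorem leftRow_natAdd (r : Fin (n + n)) (c : Fin n) : leftRow x r (Fin.natAdd n c) = 0 :=
  Fin.append_right _ _ _

theorem rightRow_castAdd (r : Fin (n + n)) (c : Fin n) : rightRow x r (Fin.castAdd n c) = 0 :=
  Fin.append_left _ _ _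

theorem rightRow_natAdd (r : Fin (n + n)) (c : Fin n) :
    rightRow x r (Fin.natAdd n c) = (-1) ^ (r : ℕ) * x r ^ (c : ℕ) := Fin.append_right _ _ _

theorem det_piecewise_rows_of_card_ne {S : Finset (Fin (n + n))} (h : S.card ≠ n) :
    (Matrix.of (S.piecewise (leftRow x) (rightRow x))).det = 0 := by
  have hc := Finset.card_compl_add_card S
  rw [Fintype.card_fin] at hc
  rcases lt_or_gt_of_ne h with h | h
  · refine det_eq_zero_of_zero_block _ Sᶜ (Finset.univ.map (Fin.castAddEmb n)) ?_ ?_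
    · intro r hr c hc
      obtain ⟨c, -, rfl⟩ := Finset.mem_map.1 hc
      rw [Matrix.of_apply, Finset.piecewise_eq_of_notMem _ _ _ (Finset.mem_compl.1 hr)]
      exact rightRow_castAdd x r c
    · simp only [Fintype.card_fin, Finset.card_map, Finset.card_fin]
      omega
  · refine det_eq_zero_of_zero_block _ S (Finset.univ.map (Fin.natAddEmb n)) ?_ ?_
    · intro r hr c hc
      obtain ⟨c, -, rfl⟩ := Finset.mem_map.1 hc
      rw [Matrix.of_apply, Finset.piecewise_eq_of_mem _ _ _ hr]
      exact leftRow_natAdd x r c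
    · simp only [Fintype.card_fin, Finset.card_map, Finset.card_fin]
      omega

/-- Sorting the rows by membership in `S` makes the matrix block diagonal. The alternating signs
built into `rightRow` cancel the dependence of the shuffle sign on `S`. -/
theorem det_piecewise_rows {S : Finset (Fin (n + n))} (hS : S.card = n) (hSc : Sᶜ.card = n) :
    (Matrix.of (S.piecewise (leftRow x) (rightRow x))).det =
      (∏ b : Fin n, (-1 : ℚ) ^ (n + b : ℕ)) *
        ((Matrix.vandermonde fun a => x (S.orderEmbOfFin hS a)).det *
          (Matrix.vandermonde fun b => x (Sᶜ.orderEmbOfFin hSc b)).det) := by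
  set M := Matrix.of (S.piecewise (leftRow x) (rightRow x)) with hM
  have hsub : (M.submatrix (shufflePerm hS hSc) id).submatrix finSumFinEquiv finSumFinEquiv =
      Matrix.fromBlocks (Matrix.vandermonde fun a => x (S.orderEmbOfFin hS a)) 0 0
        (Matrix.of fun b c => (fun b => (-1 : ℚ) ^ (Sᶜ.orderEmbOfFin hSc b : ℕ)) b *
          (Matrix.vandermonde fun b => x (Sᶜ.orderEmbOfFin hSc b)) b c) := by
    have hl : ∀ a, S.orderEmbOfFin hS a ∈ S := Finset.orderEmbOfFin_mem S hS
    have hr : ∀ b, Sᶜ.orderEmbOfFin hSc b ∉ S := fun b =>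
      Finset.mem_compl.1 (Finset.orderEmbOfFin_mem Sᶜ hSc b)
    ext (a | b) (c | c) <;>
      simp only [Matrix.submatrix_apply, finSumFinEquiv_apply_left, finSumFinEquiv_apply_right,
        shufflePerm_castAdd, shufflePerm_natAdd, hM, Matrix.of_apply, Finset.piecewise, hl, hr,
        if_true, if_false, id, leftRow_castAdd, leftRow_natAdd, rightRow_castAdd, rightRow_natAdd,
        Matrix.fromBlocks_apply₁₁, Matrix.fromBlocks_apply₁₂, Matrix.fromBlocks_apply₂₁,
        Matrix.fromBlocks_apply₂₂, Matrix.vandermonde_apply, Matrix.zero_apply]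
  have hdet := congrArg Matrix.det hsub
  rw [Matrix.det_submatrix_equiv_self, Matrix.det_permute, Matrix.det_fromBlocks_zero₁₂,
    Matrix.det_mul_column] at hdet
  have hsq : ((Equiv.Perm.sign (shufflePerm hS hSc) : ℤ) : ℚ) *
      ((Equiv.Perm.sign (shufflePerm hS hSc) : ℤ) : ℚ) = 1 := by
    rcases Int.units_eq_one_or (Equiv.Perm.sign (shufflePerm hS hSc)) with h | h <;> simp [h]
  rw [← sign_shufflePerm_mul hS hSc]
  linear_combination (-M.det) * hsq + ((Equiv.Perm.sign (shufflePerm hS hSc) : ℤ) : ℚ) * hdet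

/-- The rows with even index. -/
def evenIndices (n : ℕ) : Finset (Fin (n + n)) := Finset.univ.filter fun r => (r : ℕ) % 2 = 0

/-- Rows of even index are `(v | v)` and rows of odd index `(v | -v)`. They arise from `(v | 0)` and
`(0 | -v)` by right multiplication with the block matrix `Q`, of determinant `2 ^ n`. -/
theorem det_leftRow_add_rightRow :
    (Matrix.of (leftRow x + rightRow x)).det =
      2 ^ n * (Matrix.of ((evenIndices n).piecewise (leftRow x) (rightRow x))).det := by
  set Q : Matrix (Fin n ⊕ Fin n) (Fin n ⊕ Fin n) ℚ := Matrix.fromBlocks 1 1 (-1) 1 with hQ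
  have hQdet : Q.det = 2 ^ n := by
    rw [hQ, Matrix.det_fromBlocks_one₁₁, mul_one, sub_neg_eq_add,
      show (1 + 1 : Matrix (Fin n) (Fin n) ℚ) = (2 : ℚ) • 1 by rw [two_smul], Matrix.det_smul]
    simp
  rw [← hQdet, mul_comm, ← Matrix.det_submatrix_equiv_self finSumFinEquiv,
    ← Matrix.det_submatrix_equiv_self finSumFinEquiv (Matrix.of ((evenIndices n).piecewise _ _)),
    ← Matrix.det_mul]
  congr 1
  have hM : ∀ M : Matrix (Fin (n + n)) (Fin (n + n)) ℚ, ∀ i c,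
      (M.submatrix finSumFinEquiv finSumFinEquiv * Q) i c =
        ∑ a, M (finSumFinEquiv i) (Fin.castAdd n a) * Q (Sum.inl a) c +
          ∑ a, M (finSumFinEquiv i) (Fin.natAdd n a) * Q (Sum.inr a) c := fun M i c => by
    simp [Matrix.mul_apply, -Fin.natAdd_eq_addNat]
  ext i c
  rw [hM, Matrix.submatrix_apply]
  generalize finSumFinEquiv i = r
  rcases Nat.mod_two_eq_zero_or_one (r : ℕ) with hr | hr
  · have hmem : r ∈ evenIndices n := by simp [evenIndices, hr]
    have hsign : (-1 : ℚ) ^ (r : ℕ) = 1 := (Nat.even_iff.2 hr).neg_one_pow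
    rcases c with c | c <;>
      simp [Finset.piecewise, hmem, leftRow_castAdd, leftRow_natAdd, rightRow_castAdd,
        rightRow_natAdd, hQ, hsign, Matrix.one_apply, -Fin.natAdd_eq_addNat]
  · have hmem : r ∉ evenIndices n := by simp [evenIndices, hr]
    have hsign : (-1 : ℚ) ^ (r : ℕ) = -1 := (Nat.odd_iff.2 hr).neg_one_pow
    rcases c with c | c <;>
      simp [Finset.piecewise, hmem, leftRow_castAdd, leftRow_natAdd, rightRow_castAdd,
        rightRow_natAdd, hQ, hsign, Matrix.one_apply, -Fin.natAdd_eq_addNat]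

end Rows

theorem image_orderEmbOfFin {α : Type*} [LinearOrder α] (S : Finset α) {j : ℕ} (h : S.card = j) :
    Finset.univ.image (S.orderEmbOfFin h) = S := by
  ext t
  have := Finset.range_orderEmbOfFin S h
  rw [← Finset.mem_coe (s := S), ← this]
  simp

theorem det_vandermonde_orderEmbOfFin {N j : ℕ} {x : Fin N → ℤ} (hx : StrictMono x)
    {S : Finset (Fin N)} (h : S.card = j) :
    (Matrix.vandermonde fun a => (x (S.orderEmbOfFin h a) : ℚ)).det = vandProd (S.image x) := by
  rw [← vandProd_image (x := fun a => x (S.orderEmbOfFin h a))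
    (hx.comp (S.orderEmbOfFin h).strictMono)]
  conv_rhs => rw [← image_orderEmbOfFin S h, Finset.image_image]
  rfl

/-- The `a`-th even index. -/
def evenIndex {n : ℕ} (a : Fin n) : Fin (n + n) := ⟨2 * a, by omega⟩

/-- The `a`-th odd index. -/
def oddIndex {n : ℕ} (a : Fin n) : Fin (n + n) := ⟨2 * a + 1, by omega⟩

theorem evenIndices_eq_image (n : ℕ) : evenIndices n = Finset.univ.image evenIndex := by
  ext r
  simp only [evenIndices, Finset.mem_filter, Finset.mem_univ, true_and, Finset.mem_image,
    evenIndex, Fin.ext_iff]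
  constructor
  · intro h
    exact ⟨⟨r / 2, by omega⟩, by simp only; omega⟩
  · rintro ⟨a, h⟩
    omega

theorem compl_evenIndices_eq_image (n : ℕ) : (evenIndices n)ᶜ = Finset.univ.image oddIndex := by
  ext r
  simp only [evenIndices, Finset.mem_compl, Finset.mem_filter, Finset.mem_univ, true_and,
    Finset.mem_image, oddIndex, Fin.ext_iff]
  constructor
  · intro h
    exact ⟨⟨r / 2, by omega⟩, by simp only; omega⟩
  · rintro ⟨a, h⟩
    omega

theorem strictMono_evenIndex (n : ℕ) : StrictMono (evenIndex (n := n)) := fun a b h => by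
  simp only [evenIndex, Fin.lt_def] at h ⊢
  omega

theorem strictMono_oddIndex (n : ℕ) : StrictMono (oddIndex (n := n)) := fun a b h => by
  simp only [oddIndex, Fin.lt_def] at h ⊢
  omega

theorem card_evenIndices (n : ℕ) : (evenIndices n).card = n := by
  rw [evenIndices_eq_image, Finset.card_image_of_injective _ (strictMono_evenIndex n).injective,
    Finset.card_fin]

/-- The sum over all balanced splittings of a set of integers of the products of the two
Vandermonde products. -/
theorem sum_vandProd_mul_vandProd_compl {n : ℕ} {x : Fin (n + n) → ℤ} (hx : StrictMono x) :
    ∑ S : Finset (Fin (n + n)), (if S.card = n then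
      vandProd (S.image x) * vandProd (Sᶜ.image x) else 0) =
      2 ^ n * (vandProd (Finset.univ.image fun a => x (evenIndex a)) *
        vandProd (Finset.univ.image fun a => x (oddIndex a))) := by
  have hcompl : ∀ S : Finset (Fin (n + n)), S.card = n → Sᶜ.card = n := fun S hS => by
    have := Finset.card_compl_add_card S
    rw [Fintype.card_fin] at this
    omega
  set K : ℚ := ∏ b : Fin n, (-1 : ℚ) ^ (n + b : ℕ) with hK
  have hK0 : K ≠ 0 := Finset.prod_ne_zero_iff.2 fun b _ => pow_ne_zero _ (by norm_num)
  have hterm : ∀ S : Finset (Fin (n + n)), (Matrix.of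
      (S.piecewise (leftRow fun r => (x r : ℚ)) (rightRow fun r => (x r : ℚ)))).det =
      K * (if S.card = n then vandProd (S.image x) * vandProd (Sᶜ.image x) else 0) := by
    intro S
    split_ifs with hS
    · rw [det_piecewise_rows _ hS (hcompl S hS), det_vandermonde_orderEmbOfFin hx,
        det_vandermonde_orderEmbOfFin hx]
    · rw [det_piecewise_rows_of_card_ne _ hS, mul_zero]
  -- Expanding every row as a sum of a left and a right row yields one determinant for each `S`.
  have hsum := (Matrix.detRowAlternating (n := Fin (n + n)) (R := ℚ)).toMultilinearMap.map_add_univ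
    (leftRow fun r => (x r : ℚ)) (rightRow fun r => (x r : ℚ))
  have hsum' : (Matrix.of ((leftRow fun r => (x r : ℚ)) + (rightRow fun r => (x r : ℚ)))).det =
      ∑ S : Finset (Fin (n + n)), (Matrix.of
        (S.piecewise (leftRow fun r => (x r : ℚ)) (rightRow fun r => (x r : ℚ)))).det := hsum
  -- `hterm` is used twice: for the whole sum, and for the single set of even indices on the other
  -- side.
  rw [det_leftRow_add_rightRow, Finset.sum_congr rfl fun S _ => hterm S, hterm,
    if_pos (card_evenIndices n), ← Finset.mul_sum] at hsum'
  have h₁ : (evenIndices n).image x = Finset.univ.image fun a => x (evenIndex a) := by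
    rw [evenIndices_eq_image, Finset.image_image]
    rfl
  have h₂ : (evenIndices n)ᶜ.image x = Finset.univ.image fun a => x (oddIndex a) := by
    rw [compl_evenIndices_eq_image, Finset.image_image]
    rfl
  rw [h₁, h₂] at hsum'
  refine mul_left_cancel₀ hK0 ?_
  rw [← hsum']
  ring

/-! ### Perfect matchings and tilings -/

theorem ShareSide.symm {p q : ℤ × ℤ} (h : ShareSide p q) : ShareSide q p := by
  simpa only [ShareSide, abs_sub_comm] using h

theorem pair_eq_pair_of_mem {α : Type*} [DecidableEq α] {p q r : α} {δ : Finset α} (hδ : δ = {p, q})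
    (hr : r ∈ δ) : ∃ w, δ = {r, w} := by
  subst hδ
  rw [Finset.mem_insert, Finset.mem_singleton] at hr
  rcases hr with rfl | rfl
  · exact ⟨q, rfl⟩
  · exact ⟨p, Finset.pair_comm _ _⟩

theorem pair_right_inj {α : Type*} [DecidableEq α] {p q r : α} (h : ({p, q} : Finset α) = {p, r})
    (hpq : p ≠ q) : q = r := by
  have : q ∈ ({p, r} : Finset α) := by
    rw [← h]
    simp
  rw [Finset.mem_insert, Finset.mem_singleton] at this
  exact this.resolve_left hpq.symm

theorem shareSide_of_isDomino {p q : ℤ × ℤ} (h : IsDomino {p, q}) : ShareSide p q := by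
  obtain ⟨p', q', hs, he⟩ := h
  have hp : p ∈ ({p', q'} : Finset (ℤ × ℤ)) := by rw [← he]; simp
  have hq : q ∈ ({p', q'} : Finset (ℤ × ℤ)) := by rw [← he]; simp
  have hp' : p' ∈ ({p, q} : Finset (ℤ × ℤ)) := by rw [he]; simp
  have hq' : q' ∈ ({p, q} : Finset (ℤ × ℤ)) := by rw [he]; simp
  simp only [Finset.mem_insert, Finset.mem_singleton] at hp hq hp' hq'
  have hne := hs.ne
  rcases hp with rfl | rfl <;> rcases hq with rfl | rfl
  · exact absurd (by tauto) hne
  · exact hs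
  · exact hs.symm
  · exact absurd (by tauto) hne

/-- The subgraph formed by the edges that are dominoes of a tiling. -/
def tilingSubgraph {S : Finset (ℤ × ℤ)} {D : Finset (Finset (ℤ × ℤ))} (hD : IsDominoTiling S D) :
    (cellGraph S).Subgraph where
  verts := Set.univ
  Adj p q := {p.1, q.1} ∈ D
  adj_sub h := shareSide_of_isDomino (hD.1 _ h).1
  edge_vert _ := Set.mem_univ _
  symm := ⟨fun p q h => by rwa [Finset.pair_comm]⟩

/-- A perfect matching, as a spanning subgraph, is determined by its edges, and these are the
dominoes of a tiling. -/
theorem numPerfectMatchings_cellGraph (S : Finset (ℤ × ℤ)) :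
    numPerfectMatchings (cellGraph S) = numDominoTilings S := by
  classical
  symm
  have hperf : ∀ D (hD : IsDominoTiling S D), (tilingSubgraph hD).IsPerfectMatching := by
    intro D hD
    refine ⟨fun p _ => ?_, fun p => Set.mem_univ p⟩
    obtain ⟨δ, ⟨hδ, hpδ⟩, hu⟩ := hD.2 p.1 p.2
    obtain ⟨u, v, -, huv⟩ := (hD.1 δ hδ).1
    obtain ⟨w, rfl⟩ := pair_eq_pair_of_mem huv hpδ
    have hwS : w ∈ S := (hD.1 _ hδ).2 (by simp)
    refine ⟨⟨w, hwS⟩, hδ, fun w' hw' => Subtype.ext ?_⟩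
    have h' : ({p.1, w'.1} : Finset (ℤ × ℤ)) ∈ D := hw'
    exact pair_right_inj (hu _ ⟨h', by simp⟩) (shareSide_of_isDomino (hD.1 _ h').1).ne
  refine Nat.card_congr (Equiv.ofBijective
    (fun D => ⟨tilingSubgraph D.2, hperf D.1 D.2⟩) ⟨?_, ?_⟩)
  · rintro ⟨D, hD⟩ ⟨D', hD'⟩ h
    have hAdj : ∀ p q : S, ({p.1, q.1} : Finset (ℤ × ℤ)) ∈ D ↔ ({p.1, q.1} : Finset (ℤ × ℤ)) ∈ D' :=
      fun p q => by
        have := congrArg (fun M => M.1.Adj p q) h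
        exact iff_of_eq this
    have hsub : ∀ D D' : Finset (Finset (ℤ × ℤ)), IsDominoTiling S D → (∀ p q : S,
        ({p.1, q.1} : Finset (ℤ × ℤ)) ∈ D → ({p.1, q.1} : Finset (ℤ × ℤ)) ∈ D') → D ⊆ D' := by
      intro D D' hD h δ hδ
      obtain ⟨⟨p, q, -, rfl⟩, hS⟩ := hD.1 δ hδ
      exact h ⟨p, hS (by simp)⟩ ⟨q, hS (by simp)⟩ hδ
    exact Subtype.ext ((hsub D D' hD fun p q => (hAdj p q).1).antisymm
      (hsub D' D hD' fun p q => (hAdj p q).2))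
  · rintro ⟨M, hM, hspan⟩
    have hmemS : ∀ (p q : S), M.Adj p q → ({p.1, q.1} : Finset (ℤ × ℤ)) ⊆ S := fun p q _ => by
      simp [Finset.insert_subset_iff]
    set D : Finset (Finset (ℤ × ℤ)) := S.powerset.filter fun δ =>
      ∃ p q : S, M.Adj p q ∧ δ = {p.1, q.1} with hDdef
    have hmem : ∀ δ, δ ∈ D ↔ ∃ p q : S, M.Adj p q ∧ δ = {p.1, q.1} := by
      intro δ
      rw [hDdef, Finset.mem_filter, Finset.mem_powerset, and_iff_right_iff_imp]
      rintro ⟨p, q, h, rfl⟩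
      exact hmemS p q h
    have hpair : ∀ (p : S) δ, δ ∈ D → p.1 ∈ δ → ∃ w, M.Adj p w ∧ δ = {p.1, w.1} := by
      intro p δ hδ hp
      obtain ⟨u, v, huv, rfl⟩ := (hmem δ).1 hδ
      rw [Finset.mem_insert, Finset.mem_singleton] at hp
      rcases hp with hp | hp
      · obtain rfl : p = u := Subtype.ext hp
        exact ⟨v, huv, rfl⟩
      · obtain rfl : p = v := Subtype.ext hp
        exact ⟨u, huv.symm, Finset.pair_comm _ _⟩
    have hD : IsDominoTiling S D := by
      refine ⟨fun δ hδ => ?_, fun p hp => ?_⟩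
      · obtain ⟨u, v, huv, rfl⟩ := (hmem δ).1 hδ
        exact ⟨⟨u, v, M.adj_sub huv, rfl⟩, hmemS u v huv⟩
      · obtain ⟨w, hw, hu⟩ := hM (hspan ⟨p, hp⟩)
        refine ⟨{p, w.1}, ⟨(hmem _).2 ⟨⟨p, hp⟩, w, hw, rfl⟩, by simp⟩, ?_⟩
        rintro δ ⟨hδ, hpδ⟩
        obtain ⟨w', hw', rfl⟩ := hpair ⟨p, hp⟩ δ hδ hpδ
        rw [hu w' hw']
    refine ⟨⟨D, hD⟩, Subtype.ext ?_⟩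
    refine SimpleGraph.Subgraph.ext ?_ ?_
    · exact (Set.eq_univ_of_forall hspan).symm
    · funext p q
      refine propext ⟨fun h => ?_, fun h => (hmem _).2 ⟨p, q, h, rfl⟩⟩
      have h : ({p.1, q.1} : Finset (ℤ × ℤ)) ∈ D := h
      obtain ⟨w, hw, he⟩ := hpair p _ h (by simp)
      obtain rfl : q = w := Subtype.ext
        (pair_right_inj he (shareSide_of_isDomino (hD.1 _ h).1).ne)
      exact hw

/-! ### Splitting along the axis -/

/-- The reflection in the row `c / 2`. -/
def reflectRow (c : ℤ) : ℤ × ℤ ↪ ℤ × ℤ where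
  toFun p := (p.1, c - p.2)
  inj' p q h := by
    simp only [Prod.mk.injEq] at h
    ext <;> omega

theorem reflectRow_apply (c : ℤ) (p : ℤ × ℤ) : reflectRow c p = (p.1, c - p.2) := rfl

theorem mem_map_reflectRow {c : ℤ} {S : Finset (ℤ × ℤ)} {p : ℤ × ℤ} :
    p ∈ S.map (reflectRow c) ↔ (p.1, c - p.2) ∈ S := by
  simp only [Finset.mem_map, reflectRow_apply]
  constructor
  · rintro ⟨q, hq, rfl⟩
    simpa using hq
  · intro h
    exact ⟨_, h, by simp⟩

theorem numDominoTilings_map_reflectRow (c : ℤ) (S : Finset (ℤ × ℤ)) :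
    numDominoTilings (S.map (reflectRow c)) = numDominoTilings S := by
  rw [numDominoTilings_eq_numExactCovers, numDominoTilings_eq_numExactCovers,
    ← numExactCovers_map (reflectRow c) _ S]
  congr 1
  have hs : ∀ p q, ShareSide p q → ShareSide (reflectRow c p) (reflectRow c q) := by
    intro p q h
    rw [shareSide_iff] at h ⊢
    simp only [reflectRow_apply]
    omega
  ext δ
  simp only [Set.mem_ofPred_eq, Set.mem_image]
  constructor
  · rintro ⟨p, q, h, rfl⟩
    refine ⟨{reflectRow c p, reflectRow c q}, ⟨_, _, hs p q h, rfl⟩, ?_⟩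
    simp [reflectRow_apply, Finset.map_insert]
  · rintro ⟨_, ⟨p, q, h, rfl⟩, rfl⟩
    exact ⟨_, _, hs p q h, by simp [Finset.map_insert]⟩

/-- The Aztec rectangle of height `2 i` and width `N` with the labels in `T` kept on the axis. -/
theorem numDominoTilings_split (N i : ℕ) (T : Finset ℤ) :
    numDominoTilings (topRows N (2 * i) ∪ evenRow (2 * i) T ∪
        (topRows N (2 * i)).map (reflectRow (4 * i))) =
      ∑ X ∈ T.powerset, numDominoTilings (topRows N (2 * i) ∪ evenRow (2 * i) X) *
        numDominoTilings (topRows N (2 * i) ∪ evenRow (2 * i) (T \ X)) := by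
  set U := topRows N (2 * i) with hU
  set G := U ∪ evenRow (2 * i) T ∪ U.map (reflectRow (4 * i)) with hG
  -- A domino occupies two adjacent rows, so it lies on exactly one side of the axis, with at most
  -- one square on the axis itself.
  let E₁ : Set (Finset (ℤ × ℤ)) := {δ | IsDomino δ ∧ ∀ p ∈ δ, p.2 ≤ 2 * i}
  let E₂ : Set (Finset (ℤ × ℤ)) := {δ | IsDomino δ ∧ ∀ p ∈ δ, 2 * (i : ℤ) ≤ p.2}
  have hE : {δ | IsDomino δ} = E₁ ∪ E₂ := by
    ext δ
    simp only [E₁, E₂, Set.mem_ofPred_eq, Set.mem_union, ← and_or_left]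
    refine ⟨fun h => ⟨h, ?_⟩, fun h => h.1⟩
    obtain ⟨p, q, h, rfl⟩ := h
    rw [shareSide_iff] at h
    simp only [Finset.forall_mem_insert, Finset.mem_singleton, forall_eq]
    omega
  have hdisj : Disjoint E₁ E₂ := by
    rw [Set.disjoint_left]
    rintro _ ⟨⟨p, q, h, rfl⟩, h₁⟩ ⟨-, h₂⟩
    rw [shareSide_iff] at h
    simp only [Finset.forall_mem_insert, Finset.mem_singleton, forall_eq] at h₁ h₂
    omega
  have hUm : ∀ p, p ∈ U ↔ _ := fun p => mem_topRows
  have hGm : ∀ p, p ∈ G ↔ p ∈ U ∨ p ∈ evenRow (2 * i) T ∨ (p.1, 4 * (i : ℤ) - p.2) ∈ U := by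
    intro p
    rw [hG, Finset.mem_union, Finset.mem_union, mem_map_reflectRow, or_assoc]
  have hinj : Function.Injective fun X : Finset ℤ => U ∪ evenRow (2 * i) X := by
    intro X X' h
    ext t
    have := Finset.ext_iff.1 h (2 * t - 1, 2 * i)
    simp only [Finset.mem_union, hUm, mem_evenRow] at this
    push_cast at this
    rw [show (2 * t - 1 + 1) / 2 = t by omega] at this
    constructor
    · intro ht
      have := this.1 (Or.inr ⟨trivial, by omega, ht⟩)
      exact (this.resolve_left (by omega)).2.2
    · intro ht
      have := this.2 (Or.inr ⟨trivial, by omega, ht⟩)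
      exact (this.resolve_left (by omega)).2.2
  rw [numDominoTilings_eq_numExactCovers, hE, numExactCovers_union hdisj]
  -- Only sets consisting of all of `U` and some axis squares contribute: a square strictly on one
  -- side of the axis cannot be covered by dominoes of the other side.
  rw [← Finset.sum_subset (s₁ := T.powerset.image fun X => U ∪ evenRow (2 * i) X),
    Finset.sum_image hinj.injOn]
  · refine Finset.sum_congr rfl fun X hX => ?_
    rw [Finset.mem_powerset] at hX
    congr 1
    · rw [numDominoTilings_eq_numExactCovers]
      refine numExactCovers_congr fun δ hδ => ?_
      simp only [E₁, Set.mem_ofPred_eq, and_iff_left_iff_imp]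
      intro _ p hp
      have := hδ hp
      rw [Finset.mem_union, hUm, mem_evenRow] at this
      push_cast at this
      omega
    · rw [← numDominoTilings_map_reflectRow (4 * i) (U ∪ _)]
      have hset : G \ (U ∪ evenRow (2 * i) X) = (U ∪ evenRow (2 * i) (T \ X)).map
          (reflectRow (4 * i)) := by
        ext ⟨u, v⟩
        simp only [Finset.mem_sdiff, hGm, mem_map_reflectRow, Finset.mem_union, hUm, mem_evenRow]
        push_cast
        by_cases hT : (u + 1) / 2 ∈ T <;> by_cases hX' : (u + 1) / 2 ∈ X <;>
          simp only [hT, hX', and_true, and_false, or_false, false_or, not_true,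
            not_false_iff] <;> omega
      rw [hset, numDominoTilings_eq_numExactCovers]
      refine numExactCovers_congr fun δ hδ => ?_
      simp only [E₂, Set.mem_ofPred_eq, and_iff_left_iff_imp]
      intro _ p hp
      have := hδ hp
      rw [mem_map_reflectRow, Finset.mem_union, hUm, mem_evenRow] at this
      push_cast at this
      omega
  · intro A hA
    obtain ⟨X, hX, rfl⟩ := Finset.mem_image.1 hA
    rw [Finset.mem_powerset] at hX ⊢
    intro p hp
    rw [hGm]
    rw [Finset.mem_union] at hp
    refine hp.imp_right fun h => Or.inl ?_
    rw [mem_evenRow] at h ⊢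
    exact ⟨h.1, h.2.1, hX h.2.2⟩
  · intro A hA hA'
    rw [Finset.mem_powerset] at hA
    by_cases h₁ : ∃ p ∈ A, 2 * (i : ℤ) < p.2
    · obtain ⟨p, hp, hlt⟩ := h₁
      rw [numExactCovers_eq_zero hp, zero_mul]
      intro δ hδ hpδ _
      have := hδ.2 p hpδ
      omega
    by_cases h₂ : ∃ p ∈ G \ A, p.2 < 2 * (i : ℤ)
    · obtain ⟨p, hp, hlt⟩ := h₂
      rw [numExactCovers_eq_zero hp, mul_zero]
      intro δ hδ hpδ _
      have := hδ.2 p hpδ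
      omega
    exfalso
    push Not at h₁ h₂
    refine hA' (Finset.mem_image.2 ⟨T.filter fun t => (2 * t - 1, 2 * (i : ℤ)) ∈ A,
      Finset.mem_powerset.2 (Finset.filter_subset _ _), ?_⟩)
    ext ⟨u, v⟩
    simp only [Finset.mem_union, mem_evenRow, Finset.mem_filter]
    constructor
    · rintro (h | ⟨rfl, hu, -, h⟩)
      · by_contra hnA
        have := h₂ (u, v) (Finset.mem_sdiff.2 ⟨(hGm _).2 (Or.inl h), hnA⟩)
        rw [hUm] at h
        push_cast at h
        simp only at this
        omega
      · rwa [show 2 * ((u + 1) / 2) - 1 = u by omega] at h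
    · intro h
      have hle := h₁ _ h
      rcases (hGm _).1 (hA h) with h' | h' | h'
      · exact Or.inl h'
      · rw [mem_evenRow] at h'
        obtain ⟨rfl, hu, ht⟩ := h'
        refine Or.inr ⟨rfl, hu, ht, ?_⟩
        rwa [show 2 * ((u + 1) / 2) - 1 = u by omega]
      · rw [hUm] at h'
        push_cast at h'
        simp only at hle
        omega

/-! ### Aztec rectangles with defects on the axis -/

theorem mem_RVerts {m n : ℕ} {T : Finset ℤ} {p : ℤ × ℤ} :
    p ∈ RVerts m n T ↔ (0 ≤ p.1 ∧ p.1 ≤ 2 * n ∧ 0 ≤ p.2 ∧ p.2 ≤ 2 * m ∧ (p.1 + p.2) % 2 = 1) ∧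
      ∀ t : ℤ, 1 ≤ t → t ≤ n → p.1 = 2 * t - 1 → p.2 = m → t ∈ T := by
  simp only [RVerts, aztecRect, Finset.mem_sdiff, Finset.mem_filter, Finset.mem_product,
    Finset.mem_Icc, Finset.mem_image, Int.odd_iff, Prod.ext_iff, not_exists, not_and]
  constructor
  · rintro ⟨h, h'⟩
    refine ⟨by tauto, fun t h₁ h₂ h₃ h₄ => ?_⟩
    by_contra ht
    exact h' t ⟨⟨h₁, h₂⟩, ht⟩ h₃.symm h₄.symm
  · rintro ⟨h, h'⟩
    refine ⟨by tauto, fun t ht h₃ h₄ => ?_⟩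
    exact ht.2 (h' t ht.1.1 ht.1.2 h₃.symm h₄.symm)

theorem RVerts_eq (N i : ℕ) {T : Finset ℤ} (hT : T ⊆ Finset.Icc 1 N) :
    RVerts (2 * i) N T = topRows N (2 * i) ∪ evenRow (2 * i) T ∪
        (topRows N (2 * i)).map (reflectRow (4 * i)) := by
  ext ⟨u, v⟩
  simp only [Finset.mem_union, mem_map_reflectRow, mem_RVerts, mem_topRows, mem_evenRow]
  push_cast
  constructor
  · rintro ⟨h, h'⟩
    rcases lt_trichotomy v (2 * i) with hv | hv | hv
    · left; left; omega
    · left; right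
      exact ⟨hv, by omega, h' _ (by omega) (by omega) (by omega) (by omega)⟩
    · right; omega
  · rintro ((h | ⟨h₁, h₂, h₃⟩) | h)
    · exact ⟨by omega, fun t _ _ _ _ => by omega⟩
    · have := Finset.mem_Icc.1 (hT h₃)
      refine ⟨by omega, fun t _ _ ht _ => ?_⟩
      rwa [show t = (u + 1) / 2 by omega]
    · exact ⟨by omega, fun t _ _ _ _ => by omega⟩

/-- A window of height `0` is a run of `aᵢ + 1` squares on the axis. -/
theorem aztecRectWithWindows_zero {m s : ℕ} {a : Fin s → ℕ} {d : Fin s → ℤ} (hm : Even m)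
    (h : GoodWindows m a d) : aztecRectWithWindows m 0 a d =
      RVerts m (m + ∑ i, (a i + 1)) (remainingLabels m a d) := by
  ext ⟨u, v⟩
  rw [mem_aztecRectWithWindows hm (fun i => Nat.zero_le _) h.parity, mem_RVerts]
  simp only [remainingLabels, Finset.mem_sdiff, Finset.mem_Icc, Finset.mem_biUnion,
    Finset.mem_univ, true_and, not_exists, centeredRun]
  have hm' := Nat.even_iff.1 hm
  constructor
  · rintro ⟨h₁, h₂⟩
    unfold InOuter at h₁
    refine ⟨by omega, fun t ht ht' h₃ h₄ => ⟨⟨ht, ht'⟩, fun i hi => h₂ i ?_⟩⟩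
    have := Int.even_iff.1 (h.parity i)
    unfold InWindow
    simp only at h₃ h₄ ⊢
    omega
  · rintro ⟨h₁, h₂⟩
    unfold InOuter
    refine ⟨by omega, fun i hi => ?_⟩
    have := Int.even_iff.1 (h.parity i)
    have hl := h.left i
    have hr := h.right i
    unfold InWindow at hi
    simp only at hi h₁ h₂
    refine (h₂ ((u + 1) / 2) (by omega) (by omega) (by omega) (by omega)).2 i ?_
    omega

/-- Each half contributes `halfConst n` and a Vandermonde product; unbalanced splittings of the axis
vanish by the row balance. -/
theorem numDominoTilings_RVerts {N n : ℕ} {x : Fin (n + n) → ℤ} (hx : StrictMono x)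
    (hxN : ∀ r, x r ∈ Finset.Icc (1 : ℤ) N) :
    (numDominoTilings (RVerts (2 * n) N (Finset.univ.image x)) : ℚ) =
      halfConst n ^ 2 * (2 ^ n * (vandProd (Finset.univ.image fun a => x (evenIndex a)) *
        vandProd (Finset.univ.image fun a => x (oddIndex a)))) := by
  have hsub : ∀ S : Finset (Fin (n + n)), S.image x ⊆ Finset.Icc (1 : ℤ) N := by
    intro S t ht
    obtain ⟨r, -, rfl⟩ := Finset.mem_image.1 ht
    exact hxN r
  have hpow : (Finset.univ.image x).powerset =
      Finset.univ.image fun S : Finset (Fin (n + n)) => S.image x := by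
    ext S
    rw [Finset.mem_powerset, Finset.subset_image_iff]
    simp
  rw [RVerts_eq N n (hsub _), numDominoTilings_split, hpow,
    Finset.sum_image (Finset.image_injective hx.injective).injOn,
    ← sum_vandProd_mul_vandProd_compl hx, Nat.cast_sum, Finset.mul_sum]
  refine Finset.sum_congr rfl fun S _ => ?_
  have hcard : (S.image x).card = S.card := Finset.card_image_of_injective _ hx.injective
  rw [← Finset.image_sdiff _ _ hx.injective, ← Finset.compl_eq_univ_sdiff]
  split_ifs with hS
  · have hSc : (Sᶜ.image x).card = n := by
      have := Finset.card_compl_add_card S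
      rw [Fintype.card_fin] at this
      rw [Finset.card_image_of_injective _ hx.injective]
      omega
    rw [Nat.cast_mul, numDominoTilings_half N n _ (hsub S) (by rw [hcard, hS]),
      numDominoTilings_half N n _ (hsub Sᶜ) hSc]
    ring
  · rw [numDominoTilings_half_eq_zero N n (by rwa [hcard])]
    simp

theorem det_vandermonde_eq_prod_Icc {n : ℕ} (f : ℕ → ℚ) :
    (Matrix.vandermonde fun a : Fin n => f (a + 1)).det =
      ∏ j ∈ Finset.Icc 1 n, ∏ i ∈ Finset.Ico 1 j, (f j - f i) := by
  rw [Matrix.det_vandermonde]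
  have hIoi : ∀ a : Fin n, Finset.Ioi a = Finset.univ.filter (a < ·) := fun a => by
    ext
    simp
  simp only [hIoi, Finset.prod_filter]
  rw [Finset.prod_comm, show Finset.Icc 1 n = Finset.Ico 1 (n + 1) from rfl,
    Finset.prod_Ico_eq_prod_range, Nat.add_sub_cancel, ← Fin.prod_univ_eq_prod_range
      (fun j => ∏ i ∈ Finset.Ico 1 (1 + j), (f (1 + j) - f i)) n]
  refine Finset.prod_congr rfl fun b _ => ?_
  rw [Finset.prod_Ico_eq_prod_range, Nat.add_sub_cancel_left]
  simp only [Fin.lt_def]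
  rw [Fin.prod_univ_eq_prod_range (fun i => if i < (b : ℕ) then f (b + 1) - f (i + 1) else 1) n,
    ← Finset.prod_filter]
  have : (Finset.range n).filter (fun i => i < (b : ℕ)) = Finset.range b := by
    ext i
    simp only [Finset.mem_filter, Finset.mem_range]
    omega
  rw [this]
  exact Finset.prod_congr rfl fun i _ => by rw [add_comm 1 (b : ℕ), add_comm 1 i]

theorem numDominoTilings_RVerts_eq {m N : ℕ} (hm : Even m) {T : Finset ℤ}
    (hT : T ⊆ Finset.Icc (1 : ℤ) N) {t : ℕ → ℤ} (ht : StrictMonoOn t (Set.Icc 1 m))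
    (htT : (Finset.Icc 1 m).image t = T) :
    (numDominoTilings (RVerts m N T) : ℚ) =
      2 ^ (m * (m + 4) / 4) / (∏ i ∈ Finset.range (m / 2), (i.factorial : ℚ)) ^ 2 *
            ∏ j ∈ Finset.Icc 1 (m / 2), ∏ i ∈ Finset.Ico 1 j,
              (((t (2 * j - 1) : ℚ) - t (2 * i - 1)) * ((t (2 * j) : ℚ) - t (2 * i))) := by
  obtain ⟨n, rfl⟩ := hm
  -- Labels are numbered from `1` but `Fin` from `0`, so even indices correspond to `t (2 j - 1)`
  -- and odd indices to `t (2 j)`.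
  let x : Fin (n + n) → ℤ := fun r => t (r + 1)
  have hx : StrictMono x := fun r r' h =>
    ht ⟨by omega, by omega⟩ ⟨by omega, by omega⟩ (by rw [Fin.lt_def] at h; omega)
  have hxT : Finset.univ.image x = T := by
    rw [← htT]
    ext z
    simp only [Finset.mem_image, Finset.mem_univ, true_and, Finset.mem_Icc, x]
    constructor
    · rintro ⟨r, rfl⟩
      exact ⟨r + 1, by omega, rfl⟩
    · rintro ⟨k, hk, rfl⟩
      exact ⟨⟨k - 1, by omega⟩, by simp only; rw [Nat.sub_add_cancel hk.1]⟩
  have hxN : ∀ r, x r ∈ Finset.Icc (1 : ℤ) N := fun r =>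
    hT (hxT ▸ Finset.mem_image_of_mem x (Finset.mem_univ r))
  have hn : (n + n) / 2 = n := by omega
  -- The exponent of two collects both factors `halfConst n` and the `2 ^ n` from the sum over
  -- splittings.
  have hexp : (n + n) * (n + n + 4) / 4 = n * (n + 1) / 2 * 2 + n := by
    rw [Nat.div_mul_cancel (Nat.even_mul_succ_self n).two_dvd]
    rw [show (n + n) * (n + n + 4) = 4 * (n * (n + 1) + n) by ring]
    exact Nat.mul_div_cancel_left _ (by norm_num)
  have h := numDominoTilings_RVerts hx hxN
  rw [hxT, two_mul n, vandProd_image (x := fun a => x (evenIndex a))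
    (hx.comp (strictMono_evenIndex n)), vandProd_image (x := fun a => x (oddIndex a))
    (hx.comp (strictMono_oddIndex n))] at h
  have h₁ := det_vandermonde_eq_prod_Icc (n := n) fun j => (t (2 * j - 1) : ℚ)
  have h₂ := det_vandermonde_eq_prod_Icc (n := n) fun j => (t (2 * j) : ℚ)
  rw [h, hn, hexp, pow_add, pow_mul]
  simp only [Finset.prod_mul_distrib]
  rw [← h₁, ← h₂]
  simp only [x, evenIndex, oddIndex, halfConst, div_pow]
  have e₁ : ∀ a : ℕ, 2 * (a + 1) - 1 = 2 * a + 1 := fun a => by omega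
  have e₂ : ∀ a : ℕ, 2 * (a + 1) = 2 * a + 1 + 1 := fun a => by omega
  simp only [e₁]
  simp only [e₂]
  ring

/-! ### The main theorem -/

theorem theorem3p1 (m k s : ℕ) (a : Fin s → ℕ) (d : Fin s → ℤ)
    (hm : Even m) (hk : 0 < k) (hka : ∀ i, k ≤ a i)
    -- the centers `d i / 2` are integers or half-integers, according to the parity of `a i`
    (hparity : ∀ i, Even (d i - a i))
    -- the runs lie in the frame and are mutually disjoint
    (hframe : ∀ i, centeredRun (a i) (d i) ⊆ Finset.Icc (1 : ℤ) (m + ∑ j, (a j + 1) : ℕ))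
    (hdisj : ∀ i j, i ≠ j → Disjoint (centeredRun (a i) (d i)) (centeredRun (a j) (d j))) :
    numDominoTilings (aztecRectWithWindows m k a d) =
        2 ^ ((k + 1).choose 2 * (s + 1) + k * m) *
          numDominoTilings (aztecRectWithWindows m 0 a d) ∧
    numDominoTilings (aztecRectWithWindows m k a d) =
        2 ^ ((k + 1).choose 2 * (s + 1) + k * m) *
          numPerfectMatchings
            (RGraph m (m + ∑ i, (a i + 1)) (remainingLabels m a d)) ∧
    -- `t 1 < t 2 < ⋯ < t m` are the remaining labels
    ∀ t : ℕ → ℤ, StrictMonoOn t (Set.Icc 1 m) →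
      (Finset.Icc 1 m).image t = remainingLabels m a d →
      (numDominoTilings (aztecRectWithWindows m k a d) : ℚ) =
        2 ^ ((k + 1).choose 2 * (s + 1) + k * m) *
          (2 ^ (m * (m + 4) / 4) / (∏ i ∈ Finset.range (m / 2), (i.factorial : ℚ)) ^ 2 *
            ∏ j ∈ Finset.Icc 1 (m / 2), ∏ i ∈ Finset.Ico 1 j,
              (((t (2 * j - 1) : ℚ) - t (2 * i - 1)) * ((t (2 * j) : ℚ) - t (2 * i)))) := by
  have h : GoodWindows m a d :=
    { parity := hparity
      left := fun i => ((centeredRun_subset_iff (hparity i)).1 (hframe i)).1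
      right := fun i => ((centeredRun_subset_iff (hparity i)).1 (hframe i)).2
      disj := fun i j hij =>
        (disjoint_centeredRun_iff (hparity i) (hparity j)).1 (hdisj i j hij) }
  have h₁ := h.numDominoTilings_eq hm k hka
  have hT : remainingLabels m a d ⊆ Finset.Icc (1 : ℤ) (m + ∑ j, (a j + 1) : ℕ) :=
    Finset.sdiff_subset
  refine ⟨h₁, ?_, fun t ht htT => ?_⟩
  · rw [h₁, RGraph, numPerfectMatchings_cellGraph, aztecRectWithWindows_zero hm h]
  · rw [h₁, aztecRectWithWindows_zero hm h, Nat.cast_mul,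
      numDominoTilings_RVerts_eq hm hT ht htT]
    push_cast
    rfl
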